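/- Let $p,q$ be coprime positive integers, let $K_{p,q}\subset S^3$ be the torus knot of type $(p,q)$ with exterior $E(K_{p,q})$ and knot group $G_{p,q}=\pi_1(E(K_{p,q}))=\langle x,y\mid x^p=y^q\rangle$, and let $n\ge 1$. Let $\mathcal X_n^*$ be the set of characters $\chi_\rho=\operatorname{tr}\rho$ of irreducible representations $\rho\colon G_{p,q}\to \mathrm{SL}_n(\mathbb C)$, regarded as a subspace of the $\mathrm{SL}_n(\mathbb C)$-character variety of $G_{p,q}$ with its classical topology. Let $\tau_\rho(E(K_{p,q}))\in\mathbb C/\{\pm1\}$ be the Reidemeister torsion: if $\rho$ is acyclic, i.e. $H_*(E(K_{p,q});\mathbb C^n_\rho)=0$, it is $\pm\prod_j(\det[\mathbf b_j\widetilde{\mathbf b}_{j-1}/\mathbf c_j])^{(-1)^{j+1}}$, where $\mathbf c_j$ is the basis of $C_j=C_j(E(K_{p,q});\mathbb C^n_\rho)$ given by the $j$-cells of a cell decomposition, $\mathbf b_j$ is a basis of $\operatorname{Im}(\partial_{j+1}\colon C_{j+1}\to C_j)$, and $\widetilde{\mathbf b}_{j}$ is a lift of $\mathbf b_{j}$ to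 $C_{j+1}$; if $\rho$ is not acyclic, it is $0$. Then $\tau_\rho(E(K_{p,q}))$ is well defined up to sign, depends only on $\chi_\rho$ for irreducible $\rho$, and, for a suitable choice of signs, is a locally constant function $\mathcal X_n^*\to\mathbb C$. Its values are algebraic integers. Moreover, if $n\ge2$ and $\rho$ is irreducible, then $\rho(x)^p=\rho(y)^q=\omega I_n$ for some $\omega\in\mathbb C$ with $\omega^n=1$, and, with $\alpha_1,\dots,\alpha_n$ and $\beta_1,\dots,\beta_n$ the eigenvalues of $\rho(x)$ and $\rho(y)$ (with multiplicity), the same choice of signs gives $$\tau_\rho(E(K_{p,q}))=\lim_{t\to1}\frac{(t^{pq}\omega-1)^n}{\prod_{i=1}^n(t^q\alpha_i-1)\prod_{j=1}^n(t^p\beta_j-1)};$$ in particular, if no $\alpha_i$ and no $\beta_j$ equals $1$ (for instance if $\omega\neq1$), then $$\tau_\rho(E(K_{p,q}))=\frac{(\omega-1)^n}{\prod_{i=1}^n(\alpha_i-1)\prod_{j=1}^n(\beta_j-1)}.$$ -/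

import Mathlib

open Filter Topology

noncomputable section

/-! ## Based chain complexes over an integral group ring -/

/-- A finite based complex of free `ℤ[G]`-modules, bounded below by degree `0`.

For a finite CW complex `N` with `π₁(N) = G`, the cellular chain complex `C_*(Ñ; ℤ)` of the universal
cover is of this kind: `cell j` is the set of `j`-cells of `N` (one chosen lift and orientation for
each), and `bd j` is the matrix of `∂_{j+1} : C_{j+1}(Ñ) → C_j(Ñ)`, whose row indexed by the
`(j+1)`-cell `e` lists the coefficients in `ℤ[G]` of `∂ e`. Chains are row vectors, so that
composition of boundary maps is the matrix product `bd (j + 1) * bd j`. -/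
structure BasedComplex (G : Type) [Group G] where
  /-- the cells of each dimension -/
  cell : ℕ → Type
  [fintypeCell : ∀ j, Fintype (cell j)]
  [decEqCell : ∀ j, DecidableEq (cell j)]
  /-- the boundary matrices -/
  bd : ∀ j, Matrix (cell (j + 1)) (cell j) (MonoidAlgebra ℤ G)
  bd_comp_bd : ∀ j, bd (j + 1) * bd j = 0
  /-- a bound for the dimensions of the cells -/
  dim : ℕ
  isEmpty_cell : ∀ j, dim < j → IsEmpty (cell j)

attribute [instance] BasedComplex.fintypeCell BasedComplex.decEqCell

namespace BasedComplex

variable {G : Type} [Group G]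

/-! ### Simple equivalence -/

/-- Direct sum of based complexes. -/
def directSum (C D : BasedComplex G) : BasedComplex G where
  cell j := C.cell j ⊕ D.cell j
  bd j := Matrix.fromBlocks (C.bd j) 0 0 (D.bd j)
  bd_comp_bd j := by
    simp [Matrix.fromBlocks_multiply, C.bd_comp_bd, D.bd_comp_bd]
  dim := max C.dim D.dim
  isEmpty_cell j hj := by
    have h₁ := C.isEmpty_cell j (lt_of_le_of_lt (le_max_left _ _) hj)
    have h₂ := D.isEmpty_cell j (lt_of_le_of_lt (le_max_right _ _) hj)
    infer_instance

/-- The trivial based complex with `m` cancelling pairs of cells: the `s`-th pair consists of a cell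
of dimension `d s` and a cell of dimension `d s + 1` whose boundary is the former. -/
def trivialPairs (G : Type) [Group G] {m : ℕ} (d : Fin m → ℕ) : BasedComplex G where
  cell j := {s : Fin m // d s = j} ⊕ {s : Fin m // d s + 1 = j}
  bd _ := Matrix.fromBlocks 0 0 (Matrix.of fun s s' => if s.1 = s'.1 then 1 else 0) 0
  bd_comp_bd j := by
    simp [Matrix.fromBlocks_multiply]
  dim := Finset.univ.sup d + 1
  isEmpty_cell j hj := by
    have h : ∀ s, d s ≤ Finset.univ.sup d := fun s => Finset.le_sup (Finset.mem_univ s)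
    refine isEmpty_sum.2 ⟨⟨fun s => ?_⟩, ⟨fun s => ?_⟩⟩
    · have := h s.1
      have := s.2
      omega
    · have := h s.1
      have := s.2
      omega

/-- The group of simple automorphisms of a based free `ℤ[G]`-module: the matrices which are products
of elementary matrices `1 + a E_{ik}` (`i ≠ k`, `a ∈ ℤ[G]`) and of diagonal matrices with one diagonal
entry `± g` (`g ∈ G`) and all others `1`. (The inverses of these generators are again generators.) -/
def simpleMatrices (G : Type) [Group G] (I : Type) [Fintype I] [DecidableEq I] :
    Submonoid (Matrix I I (MonoidAlgebra ℤ G)) :=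
  Submonoid.closure
    ({M | ∃ (i k : I) (a : MonoidAlgebra ℤ G), i ≠ k ∧ M = 1 + Matrix.single i k a} ∪
     {M | ∃ (i : I) (ε : ℤˣ) (g : G),
        M = Matrix.diagonal (Function.update 1 i (MonoidAlgebra.single g (ε : ℤ)))})

/-- A simple isomorphism: an isomorphism of chain complexes which in each degree is, after a bijection
between the two bases, a product of elementary matrices and trivial units. -/
def SimpleIso (C D : BasedComplex G) : Prop :=
  ∃ f : ∀ j, Matrix (C.cell j) (D.cell j) (MonoidAlgebra ℤ G),
    (∀ j, ∃ (σ : C.cell j ≃ D.cell j), ∃ M ∈ simpleMatrices G (C.cell j),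
      f j = M.submatrix id σ.symm) ∧
    ∀ j, f (j + 1) * D.bd j = C.bd j * f j

/-- Simple equivalence of based complexes: simple isomorphism after adding cancelling pairs of cells.
On cellular chain complexes of universal covers this is the equivalence relation generated by changes
of the lifts and orientations of the cells, by handle slides, and by elementary expansions and
collapses; the complexes of any two cell decompositions of the same compact manifold are related in
this way. -/
def SimpleEquiv (C D : BasedComplex G) : Prop :=
  ∃ (m m' : ℕ) (d : Fin m → ℕ) (d' : Fin m' → ℕ),
    SimpleIso (C.directSum (trivialPairs G d)) (D.directSum (trivialPairs G d'))

/-! ### Reidemeister torsion -/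

variable {n : ℕ}

/-- The ring homomorphism `ℤ[G] → Mat_n(ℂ)` extending `ρ : G → SL_n(ℂ)` linearly. -/
def groupRingHom (ρ : G →* Matrix.SpecialLinearGroup (Fin n) ℂ) :
    MonoidAlgebra ℤ G →ₐ[ℤ] Matrix (Fin n) (Fin n) ℂ :=
  MonoidAlgebra.lift ℤ (Matrix (Fin n) (Fin n) ℂ) G
    { toFun := fun g => (ρ g : Matrix (Fin n) (Fin n) ℂ)
      map_one' := by simp
      map_mul' := fun g h => by simp }

variable (C : BasedComplex G) (ρ : G →* Matrix.SpecialLinearGroup (Fin n) ℂ)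

/-- The twisted chain space `C_j(N; ℂⁿ_ρ) = ℂⁿ ⊗_{ℤ[G]} C_j(Ñ)`, where `G` acts on the row vectors
`ℂⁿ` from the right through `ρ`. The standard basis, indexed by pairs (`j`-cell, coordinate of `ℂⁿ`),
is the basis `c_j` coming from the cells. -/
abbrev Chain (C : BasedComplex G) (n : ℕ) (j : ℕ) : Type := C.cell j × Fin n → ℂ

/-- The twisted boundary map `C_{j+1}(N; ℂⁿ_ρ) → C_j(N; ℂⁿ_ρ)`: its matrix (acting on row vectors from
the right) consists of the `n × n` blocks `ρ(∂_{ik})`, where `∂_{ik} ∈ ℤ[G]` are the entries of the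
boundary matrix. -/
def twistedBd (j : ℕ) : C.Chain n (j + 1) →ₗ[ℂ] C.Chain n j :=
  Matrix.vecMulLinear
    (Matrix.of fun (s : C.cell (j + 1) × Fin n) (t : C.cell j × Fin n) =>
      groupRingHom ρ (C.bd j s.1 t.1) s.2 t.2)

/-- `ρ` is acyclic on the complex: all twisted homology groups vanish. -/
def Acyclic : Prop :=
  LinearMap.range (C.twistedBd ρ 0) = ⊤ ∧
    ∀ j, LinearMap.ker (C.twistedBd ρ j) = LinearMap.range (C.twistedBd ρ (j + 1))

/-- The choices made in the definition of the torsion: a basis `b_j` of `Im ∂_{j+1}` for each `j`, a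
lift `b̃_j` of it to `C_{j+1}`, and an enumeration of `b_j b̃_{j-1}` by the basis `c_j` (that is,
orderings of both, which only influence signs). -/
structure TorsionChoice where
  /-- the rank of `∂_{j+1}` -/
  r : ℕ → ℕ
  /-- the basis `b_j` of `Im ∂_{j+1} ⊆ C_j` -/
  b : ∀ j, Module.Basis (Fin (r j)) ℂ (LinearMap.range (C.twistedBd ρ j))
  /-- the lift `b̃_j` of `b_j` to `C_{j+1}` -/
  lift : ∀ j, Fin (r j) → C.Chain n (j + 1)
  twistedBd_lift : ∀ j i, C.twistedBd ρ j (lift j i) = b j i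
  /-- enumeration of `b_0` -/
  enumZero : C.cell 0 × Fin n ≃ Fin (r 0)
  /-- enumeration of `b_{j+1} b̃_j` -/
  enumSucc : ∀ j, C.cell (j + 1) × Fin n ≃ Fin (r (j + 1)) ⊕ Fin (r j)

variable {C ρ}

/-- The family `b_j b̃_{j-1}` of vectors of `C_j`. -/
def TorsionChoice.family (c : C.TorsionChoice ρ) : ∀ j, C.cell j × Fin n → C.Chain n j
  | 0 => fun k => (c.b 0 (c.enumZero k) : C.Chain n 0)
  | j + 1 => fun k =>
      Sum.elim (fun i => (c.b (j + 1) i : C.Chain n (j + 1))) (c.lift j) (c.enumSucc j k)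

/-- `∏_j (det [b_j b̃_{j-1} / c_j])^{(-1)^{j+1}}`. -/
def TorsionChoice.value (c : C.TorsionChoice ρ) : ℂ :=
  ∏ j ∈ Finset.range (C.dim + 1), (Matrix.of (c.family j)).det ^ ((-1 : ℤ) ^ (j + 1))

variable (C ρ)

/-- `z` is a value of the Reidemeister torsion, which is defined up to sign: for acyclic `ρ`, it is up
to sign the alternating product of the determinants `det [b_j b̃_{j-1} / c_j]`; for `ρ` which is not
acyclic, it is `0`. -/
def IsTorsion (z : ℂ) : Prop :=
  (C.Acyclic ρ ∧ ∃ c : C.TorsionChoice ρ, z = c.value ∨ z = -c.value) ∨ (¬ C.Acyclic ρ ∧ z = 0)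

end BasedComplex

/-! ## Torus knots -/

/-- The group `G_{p,q} = ⟨x, y | x^p = y^q⟩` of the torus knot `K_{p,q}`. -/
abbrev TorusKnotGroup (p q : ℕ) : Type :=
  PresentedGroup ({FreeGroup.of 0 ^ p * (FreeGroup.of 1 ^ q)⁻¹} : Set (FreeGroup (Fin 2)))

namespace TorusKnotGroup

/-- The generator `x`. -/
def x (p q : ℕ) : TorusKnotGroup p q := PresentedGroup.of 0

/-- The generator `y`. -/
def y (p q : ℕ) : TorusKnotGroup p q := PresentedGroup.of 1

theorem x_pow_eq_y_pow (p q : ℕ) : x p q ^ p = y p q ^ q := by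
  have h : PresentedGroup.mk ({FreeGroup.of 0 ^ p * (FreeGroup.of 1 ^ q)⁻¹} : Set (FreeGroup (Fin 2)))
      (FreeGroup.of 0 ^ p * (FreeGroup.of 1 ^ q)⁻¹) = 1 :=
    PresentedGroup.one_of_mem (Set.mem_singleton _)
  rw [map_mul, map_inv, map_pow, map_pow, mul_inv_eq_one] at h
  exact h

end TorusKnotGroup

/-- The numbers of handles of dimension `0, 1, 2, …` of the exterior of a torus knot. -/
def torusKnotHandles : ℕ → ℕ
  | 0 => 1
  | 1 => 2
  | 2 => 1
  | _ + 3 => 0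

open TorusKnotGroup in
/-- The boundary matrices for the exterior of `K_{p,q}`. -/
def torusKnotBd (p q : ℕ) : ∀ j, Matrix (Fin (torusKnotHandles (j + 1))) (Fin (torusKnotHandles j))
    (MonoidAlgebra ℤ (TorusKnotGroup p q))
  | 0 => (!![MonoidAlgebra.of ℤ _ (x p q) - 1; MonoidAlgebra.of ℤ _ (y p q) - 1] :
      Matrix (Fin 2) (Fin 1) (MonoidAlgebra ℤ (TorusKnotGroup p q)))
  | 1 => (!![∑ i ∈ Finset.range p, MonoidAlgebra.of ℤ _ (x p q ^ i),
        -∑ i ∈ Finset.range q, MonoidAlgebra.of ℤ _ (y p q ^ i)] :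
      Matrix (Fin 1) (Fin 2) (MonoidAlgebra ℤ (TorusKnotGroup p q)))
  | _ + 2 => 0

/-- The based complex of the exterior `E(K_{p,q})` for its standard handle decomposition.

The knot lies on the torus which separates `S³` into two solid tori `V₁`, `V₂`, and `E(K_{p,q})` is
obtained from `V₁` and `V₂` by gluing along the annulus which is the complement in the torus of a
neighbourhood of the knot. The core of this annulus runs `p` times along the core `x` of `V₁` and `q`
times along the core `y` of `V₂`. Gluing along a disc in the annulus first gives a handlebody with one
`0`-handle and two `1`-handles `x`, `y`; gluing the rest of the annulus attaches one `2`-handle along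
the loop `x^p y^{-q}`. In the universal cover, the boundary of the `1`-cell `x` (resp. `y`) is `x - 1`
(resp. `y - 1`) times the `0`-cell, and the boundary of the `2`-cell runs forwards through the
translates of the `1`-cell `x` by `1, x, …, x^{p-1}` and then backwards through the translates of the
`1`-cell `y` by `y^{q-1}, …, y, 1`. -/
def torusKnotExterior (p q : ℕ) : BasedComplex (TorusKnotGroup p q) where
  cell j := Fin (torusKnotHandles j)
  bd := torusKnotBd p q
  bd_comp_bd
    | 0 => by
      have h : (!![∑ i ∈ Finset.range p, MonoidAlgebra.of ℤ _ (TorusKnotGroup.x p q ^ i),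
            -∑ i ∈ Finset.range q, MonoidAlgebra.of ℤ _ (TorusKnotGroup.y p q ^ i)] :
            Matrix (Fin 1) (Fin 2) (MonoidAlgebra ℤ (TorusKnotGroup p q))) *
          !![MonoidAlgebra.of ℤ _ (TorusKnotGroup.x p q) - 1;
            MonoidAlgebra.of ℤ _ (TorusKnotGroup.y p q) - 1] = 0 := by
        refine Matrix.ext fun a b => ?_
        rw [Fin.fin_one_eq_zero a, Fin.fin_one_eq_zero b, Matrix.mul_apply, Fin.sum_univ_two]
        simp only [map_pow]
        change (∑ i ∈ Finset.range p, MonoidAlgebra.of ℤ _ (TorusKnotGroup.x p q) ^ i) *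
            (MonoidAlgebra.of ℤ _ (TorusKnotGroup.x p q) - 1) +
          (-∑ i ∈ Finset.range q, MonoidAlgebra.of ℤ _ (TorusKnotGroup.y p q) ^ i) *
            (MonoidAlgebra.of ℤ _ (TorusKnotGroup.y p q) - 1) = 0
        rw [neg_mul, geom_sum_mul, geom_sum_mul, ← map_pow, ← map_pow,
          TorusKnotGroup.x_pow_eq_y_pow, add_neg_cancel]
      exact h
    | 1 => by
      ext a
      exact a.elim0
    | j + 2 => by
      ext a
      exact a.elim0
  dim := 2
  isEmpty_cell j hj := by
    obtain ⟨k, rfl⟩ := Nat.exists_eq_add_of_le' (show 3 ≤ j from hj)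
    exact Fin.isEmpty

/-- `z` is a value of the Reidemeister torsion `τ_ρ(E(K_{p,q}))` (defined up to sign), computed from the
based complex of some decomposition of the exterior into cells. -/
def IsReidemeisterTorsion (p q : ℕ) {n : ℕ}
    (ρ : TorusKnotGroup p q →* Matrix.SpecialLinearGroup (Fin n) ℂ) (z : ℂ) : Prop :=
  ∃ C : BasedComplex (TorusKnotGroup p q), C.SimpleEquiv (torusKnotExterior p q) ∧ C.IsTorsion ρ z

/-! ## Character varieties -/

variable {G : Type} [Group G] {n : ℕ}

/-- The linear representation of `G` on `ℂⁿ` given by `ρ : G → SL_n(ℂ)`. -/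
def linearRep (ρ : G →* Matrix.SpecialLinearGroup (Fin n) ℂ) :
    Representation ℂ G (Fin n → ℂ) where
  toFun g := Matrix.toLin' (ρ g : Matrix (Fin n) (Fin n) ℂ)
  map_one' := by simp [Module.End.one_eq_id]
  map_mul' g h := by simp [Matrix.toLin'_mul, Module.End.mul_eq_comp]

/-- The character `χ_ρ(g) = tr ρ(g)`. -/
def specialCharacter (ρ : G →* Matrix.SpecialLinearGroup (Fin n) ℂ) : G → ℂ :=
  fun g => (ρ g : Matrix (Fin n) (Fin n) ℂ).trace

/-- The part `X_n^*` of the `SL_n(ℂ)`-character variety of `G` consisting of the characters of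
irreducible representations, with the topology of pointwise convergence on `G`. (For finitely generated
`G` this is the classical topology of the variety: all characters are polynomials in the traces of
finitely many elements.) -/
def irreducibleCharacters (G : Type) [Group G] (n : ℕ) : Set (G → ℂ) :=
  {χ | ∃ ρ : G →* Matrix.SpecialLinearGroup (Fin n) ℂ,
    (linearRep ρ).IsIrreducible ∧ specialCharacter ρ = χ}

end

/-! A number defined up to sign is the same thing as its square, so everything is done with squares
of determinants, for which orderings of bases do not matter. For an exact based complex the squared
torsion is independent of the bases and lifts, invariant under isomorphisms of determinant `±1`, and
multiplicative in direct sums (`Iso.sqTorsion_eq`, `sqTorsion_sum`). Elementary matrices and trivial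
units keep determinant `±1` after twisting by `ρ`, and cancelling pairs contribute `1`; hence any
complex simply equivalent to the standard one has the same torsion (`sq_eq_of_isTorsion`).

Let `X`, `Y` be the images of `x`, `y`. If `ρ` is irreducible and `n ≥ 2`, there is no common
eigenvector, so `U (X - 1) + V (Y - 1) = 1` has a solution, which splits the first boundary map. The
torsion is then, up to sign, the determinant of the block matrix with rows `(∑ X^i, -∑ Y^i)` and
`(U, V)`, also in the non-acyclic case, where both vanish (`isReidemeisterTorsion_iff`).

To compute it, replace `X`, `Y` by `t^q X`, `t^p Y`, which respects the relation `x^p = y^q`. By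
Schur's lemma `X^p = Y^q = ω`, and for generic `t` near `1` the geometric sums are quotients of
determinants that depend on eigenvalues only; letting `t → 1` gives the limit formula
(`tendsto_torsionQuotient`). This fixes the sign and shows that the torsion depends only on the
traces of powers of `X` and of `Y`. The eigenvalues are roots of unity of bounded order, so these
traces take finitely many values, and continuity on the character space gives local constancy.

For integrality, eigenspaces of `X` and of `Y` meet trivially, so a multiplicity for `X` plus one
for `Y` is at most `n`. The `n` factors of the numerator can therefore be shared out so that both
products in the denominator divide, leaving a cofactor that is an algebraic integer at `t = 1`. -/

noncomputable section

set_option linter.unusedSectionVars false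

/-! ### Squared determinants of matrices between differently indexed bases. -/

namespace Matrix

variable {I J K I' J' : Type} [Fintype I] [DecidableEq I] [Fintype J] [DecidableEq J]
  [Fintype K] [DecidableEq K] [Fintype I'] [DecidableEq I'] [Fintype J'] [DecidableEq J']

/-- The square of the determinant of a matrix whose rows and columns are indexed by types of the same
cardinality; it does not depend on the chosen bijection. -/
def sqDet (M : Matrix I J ℂ) : ℂ :=
  if h : Fintype.card I = Fintype.card J then
    (M.submatrix id (Fintype.equivOfCardEq h)).det ^ 2 else 0

/-- Two choices of bijection differ by a permutation of the columns, whose sign disappears on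
squaring. -/
theorem det_submatrix_sq (M : Matrix I J ℂ) (e : I ≃ J) (f : I' ≃ I) (f' : I' ≃ J) :
    (M.submatrix id e).det ^ 2 = (M.submatrix f f').det ^ 2 := by
  have h : M.submatrix f f' =
      ((M.submatrix id e).submatrix id ((f.symm.trans f').trans e.symm)).submatrix f f := by
    ext i j; simp
  rw [h, det_submatrix_equiv_self, det_permute', mul_pow]
  rcases Int.units_eq_one_or (Equiv.Perm.sign ((f.symm.trans f').trans e.symm)) with h | h <;>
    simp [h]

theorem sqDet_eq (M : Matrix I J ℂ) (f : I' ≃ I) (f' : I' ≃ J) :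
    sqDet M = (M.submatrix f f').det ^ 2 := by
  have h : Fintype.card I = Fintype.card J := Fintype.card_congr (f.symm.trans f')
  rw [sqDet, dif_pos h]
  exact det_submatrix_sq M _ f f'

theorem sqDet_square (M : Matrix I I ℂ) : sqDet M = M.det ^ 2 :=
  sqDet_eq M (Equiv.refl I) (Equiv.refl I)

theorem sqDet_submatrix (M : Matrix I J ℂ) (e : I' ≃ I) (f : J' ≃ J) :
    sqDet (M.submatrix e f) = sqDet M := by
  by_cases h : Fintype.card I = Fintype.card J
  · obtain ⟨g⟩ := Fintype.card_eq.1 h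
    rw [sqDet_eq M e (e.trans g), sqDet_eq (M.submatrix e f) (Equiv.refl _) ((e.trans g).trans f.symm)]
    congr 2
    ext i j; simp
  · rw [sqDet, sqDet, dif_neg h, dif_neg]
    rwa [Fintype.card_congr e, Fintype.card_congr f]

theorem sqDet_one_submatrix (e : I ≃ J) : sqDet ((1 : Matrix J J ℂ).submatrix e id) = 1 := by
  have := sqDet_submatrix (1 : Matrix J J ℂ) e (Equiv.refl J)
  rw [sqDet_square, det_one, one_pow] at this
  exact this

theorem sqDet_mul (M : Matrix I J ℂ) (N : Matrix J K ℂ) (e : I ≃ J) (f : J ≃ K) :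
    sqDet (M * N) = sqDet M * sqDet N := by
  rw [sqDet_eq M (Equiv.refl I) e, sqDet_eq N (Equiv.refl J) f, sqDet_eq (M * N) (Equiv.refl I) (e.trans f),
    ← mul_pow, ← det_submatrix_equiv_self e (N.submatrix _ _), ← det_mul]
  congr 2
  ext i j
  simp only [submatrix_apply, mul_apply, Equiv.refl_apply]
  exact (Equiv.sum_comp e (fun k => M i k * N k (f (e j)))).symm

theorem sqDet_fromBlocks_zero (A : Matrix I J ℂ) (C : Matrix I' J ℂ) (D : Matrix I' J' ℂ)
    (e : I ≃ J) (f : I' ≃ J') :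
    sqDet (fromBlocks A 0 C D) = sqDet A * sqDet D := by
  rw [sqDet_eq A (Equiv.refl I) e, sqDet_eq D (Equiv.refl _) f, ← mul_pow,
    sqDet_eq (fromBlocks A 0 C D) (Equiv.refl _) (Equiv.sumCongr e f), ← det_fromBlocks_zero₁₂ _
      (C.submatrix id e) _]
  congr 2
  ext i j
  rcases i with i | i <;> rcases j with j | j <;> simp

theorem exists_inverse_of_sqDet_ne_zero (M : Matrix I J ℂ) (h : sqDet M ≠ 0) :
    ∃ N : Matrix J I ℂ, M * N = 1 ∧ N * M = 1 := by
  have hc : Fintype.card I = Fintype.card J := by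
    by_contra hc
    exact h (by rw [sqDet, dif_neg hc])
  obtain ⟨e⟩ := Fintype.card_eq.1 hc
  rw [sqDet_eq M (Equiv.refl I) e] at h
  have hu : IsUnit (M.submatrix (Equiv.refl I) e).det := by
    rw [isUnit_iff_ne_zero]; exact fun h0 => h (by rw [h0]; simp)
  obtain ⟨A, hA⟩ : ∃ A, M.submatrix (Equiv.refl I) e = A := ⟨_, rfl⟩
  have hM : M = A.submatrix (Equiv.refl I) e.symm := by ext; simp [← hA]
  rw [hA] at hu
  refine ⟨A⁻¹.submatrix e.symm (Equiv.refl I), ?_, ?_⟩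
  · rw [hM, submatrix_mul_equiv, mul_nonsing_inv _ hu]
    simp
  · rw [hM, submatrix_mul_equiv, nonsing_inv_mul _ hu]
    simp

theorem exists_mul_eq_of_rows {R : Type} [Fintype R] (B : Matrix R J ℂ) (W : Matrix K J ℂ)
    (h : ∀ k, ∃ v, v ᵥ* B = W k) :
    ∃ P : Matrix K R ℂ, P * B = W := by
  choose v hv using h
  refine ⟨Matrix.of v, ?_⟩
  ext k j
  rw [← hv k]
  rfl

end Matrix

/-! ### Torsion of exact based complexes over `ℂ`. -/

open Matrix

/-- A finite complex of based complex vector spaces. The boundary maps act on row vectors from the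
right. -/
structure MatrixComplex where
  I : ℕ → Type
  [fintypeI : ∀ j, Fintype (I j)]
  [decEqI : ∀ j, DecidableEq (I j)]
  d : ∀ j, Matrix (I (j + 1)) (I j) ℂ
  d_mul_d : ∀ j, d (j + 1) * d j = 0
  dim : ℕ
  isEmpty_I : ∀ j, dim < j → IsEmpty (I j)

attribute [instance] MatrixComplex.fintypeI MatrixComplex.decEqI

namespace MatrixComplex

variable (A B : MatrixComplex)

/-- Vanishing of homology. -/
def Exact : Prop :=
  (∀ v, ∃ u, u ᵥ* A.d 0 = v) ∧ ∀ j v, v ᵥ* A.d j = 0 → ∃ u, u ᵥ* A.d (j + 1) = v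

/-- Bases (the rows of `B j`) of the images of the boundary maps, together with lifts (the rows of
`L j`). The condition on cardinalities says that the complex is exact. -/
structure Splitting where
  R : ℕ → Type
  [fintypeR : ∀ j, Fintype (R j)]
  [decEqR : ∀ j, DecidableEq (R j)]
  B : ∀ j, Matrix (R j) (A.I j) ℂ
  L : ∀ j, Matrix (R j) (A.I (j + 1)) ℂ
  L_mul_d : ∀ j, L j * A.d j = B j
  span : ∀ j u, ∃ v, v ᵥ* B j = u ᵥ* A.d j
  indep : ∀ j v, v ᵥ* B j = 0 → v = 0
  card_zero : Fintype.card (R 0) = Fintype.card (A.I 0)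
  card_succ : ∀ j, Fintype.card (R (j + 1)) + Fintype.card (R j) = Fintype.card (A.I (j + 1))

attribute [instance] Splitting.fintypeR Splitting.decEqR

namespace Splitting

variable {A B} (s : A.Splitting)

/-- The square of the determinant of the basis `b_j b̃_{j-1}`. -/
def sq : ℕ → ℂ
  | 0 => sqDet (s.B 0)
  | j + 1 => sqDet (fromRows (s.B (j + 1)) (s.L j))

/-- The square of the torsion. -/
def sqTorsion : ℂ := ∏ j ∈ Finset.range (A.dim + 1), s.sq j ^ ((-1 : ℤ) ^ (j + 1))

theorem B_mul_d (j : ℕ) : s.B (j + 1) * A.d j = 0 := by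
  rw [← s.L_mul_d, Matrix.mul_assoc, A.d_mul_d, Matrix.mul_zero]

theorem card_sum (j : ℕ) :
    Fintype.card (s.R (j + 1) ⊕ s.R j) = Fintype.card (A.I (j + 1)) := by
  rw [Fintype.card_sum, s.card_succ]

/-- The boundary map kills `b_{j+1}` and sends the lift to `b_j`. Independence of `b_j` removes the
lift coefficients, and independence of `b_{j+1}` the others. -/
theorem vecMul_eq_zero (j : ℕ) (v : s.R (j + 1) ⊕ s.R j → ℂ)
    (h : v ᵥ* fromRows (s.B (j + 1)) (s.L j) = 0) : v = 0 := by
  rw [vecMul_fromRows] at h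
  have h2 : v ∘ Sum.inr = 0 := by
    apply s.indep j
    have := congrArg (fun w => w ᵥ* A.d j) h
    simpa [add_vecMul, vecMul_vecMul, s.B_mul_d, s.L_mul_d] using this
  have h1 : v ∘ Sum.inl = 0 := by
    apply s.indep (j + 1)
    simpa [h2] using h
  ext (i | i)
  · exact congrFun h1 i
  · exact congrFun h2 i

theorem _root_.Matrix.sqDet_ne_zero_of_vecMul {I J : Type} [Fintype I] [DecidableEq I] [Fintype J]
    [DecidableEq J] (M : Matrix I J ℂ) (hc : Fintype.card I = Fintype.card J)
    (h : ∀ v, v ᵥ* M = 0 → v = 0) : sqDet M ≠ 0 := by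
  obtain ⟨e⟩ := Fintype.card_eq.1 hc
  rw [sqDet_eq M (Equiv.refl I) e]
  refine pow_ne_zero 2 fun h0 => ?_
  obtain ⟨v, hv, hv0⟩ := exists_vecMul_eq_zero_iff.2 h0
  refine hv (h v ?_)
  ext j
  have := congrFun hv0 (e.symm j)
  simpa [vecMul, dotProduct] using this

theorem sq_ne_zero (j : ℕ) : s.sq j ≠ 0 := by
  cases j with
  | zero => exact sqDet_ne_zero_of_vecMul _ s.card_zero (s.indep 0)
  | succ j => exact sqDet_ne_zero_of_vecMul _ (s.card_sum j) (s.vecMul_eq_zero j)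

theorem _root_.Matrix.sqDet_of_isEmpty {I J : Type} [Fintype I] [DecidableEq I] [Fintype J]
    [DecidableEq J] (M : Matrix I J ℂ) [IsEmpty I] [IsEmpty J] : sqDet M = 1 := by
  rw [sqDet_eq M (Equiv.refl I) (Equiv.equivOfIsEmpty I J), det_isEmpty, one_pow]

theorem isEmpty_R (j : ℕ) (h : A.dim ≤ j) : IsEmpty (s.R j) := by
  have := A.isEmpty_I (j + 1) (by omega)
  have h2 := s.card_succ j
  rw [Fintype.card_eq_zero (α := A.I (j + 1))] at h2
  exact Fintype.card_eq_zero_iff.1 (by omega)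

theorem sq_eq_one (j : ℕ) (h : A.dim < j) : s.sq j = 1 := by
  have := A.isEmpty_I j h
  cases j with
  | zero => omega
  | succ j =>
    have := s.isEmpty_R (j + 1) h.le
    have := s.isEmpty_R j (by omega)
    exact sqDet_of_isEmpty _

theorem sqTorsion_eq (N : ℕ) (h : A.dim ≤ N) :
    s.sqTorsion = ∏ j ∈ Finset.range (N + 1), s.sq j ^ ((-1 : ℤ) ^ (j + 1)) := by
  refine Finset.prod_subset (Finset.range_mono (by omega)) fun j _ hj => ?_
  rw [s.sq_eq_one j (by simpa using hj), _root_.one_zpow]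

/-- By the cardinality conditions the family `b_{j+1} b̃_j` is a basis. Expand a cycle in it and
apply the boundary map: the lift coefficients vanish, so the cycle is a combination of boundaries.
-/
theorem exact {A : MatrixComplex} (s : A.Splitting) : A.Exact := by
  refine ⟨fun v => ?_, fun j v hv => ?_⟩
  · obtain ⟨N, -, hN⟩ := exists_inverse_of_sqDet_ne_zero _ (s.sq_ne_zero 0)
    refine ⟨v ᵥ* N ᵥ* s.L 0, ?_⟩
    rw [vecMul_vecMul, s.L_mul_d, vecMul_vecMul, hN, vecMul_one]
  · obtain ⟨N, -, hN⟩ := exists_inverse_of_sqDet_ne_zero _ (s.sq_ne_zero (j + 1))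
    have h1 : (v ᵥ* N) ᵥ* fromRows (s.B (j + 1)) (s.L j) = v := by
      rw [vecMul_vecMul, hN, vecMul_one]
    rw [vecMul_fromRows] at h1
    have h2 : (v ᵥ* N) ∘ Sum.inr = 0 := by
      apply s.indep j
      have := congrArg (fun w => w ᵥ* A.d j) h1
      simpa [add_vecMul, vecMul_vecMul, s.B_mul_d, s.L_mul_d, hv] using this
    refine ⟨((v ᵥ* N) ∘ Sum.inl) ᵥ* s.L (j + 1), ?_⟩
    rw [h2, zero_vecMul, add_zero] at h1
    rw [vecMul_vecMul, s.L_mul_d, h1]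

theorem exists_mul_B_eq_mul_d {K : Type} [Fintype K] [DecidableEq K] (j : ℕ)
    (W : Matrix K (A.I (j + 1)) ℂ) : ∃ P : Matrix K (s.R j) ℂ, P * s.B j = W * A.d j :=
  exists_mul_eq_of_rows _ _ fun k => s.span j (W k)

theorem exists_mul_B_eq {K : Type} [Fintype K] [DecidableEq K] (j : ℕ)
    (W : Matrix K (A.I (j + 1)) ℂ) (h : W * A.d j = 0) :
    ∃ P : Matrix K (s.R (j + 1)) ℂ, P * s.B (j + 1) = W := by
  refine exists_mul_eq_of_rows _ _ fun k => ?_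
  obtain ⟨u, hu⟩ := s.exact.2 j (W k) (congrFun h k)
  rw [← hu]
  exact s.span (j + 1) u

end Splitting

/-- An isomorphism of complexes with determinants `±1`. -/
structure Iso where
  Φ : ∀ j, Matrix (A.I j) (B.I j) ℂ
  comm : ∀ j, Φ (j + 1) * B.d j = A.d j * Φ j
  sqDet_eq_one : ∀ j, sqDet (Φ j) = 1

variable {A B}

/-- Renaming of the basis elements. -/
def Iso.ofEquiv (e : ∀ j, A.I j ≃ B.I j) (h : ∀ j, A.d j = (B.d j).submatrix (e (j + 1)) (e j)) :
    Iso A B where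
  Φ j := (1 : Matrix (B.I j) (B.I j) ℂ).submatrix (e j) id
  comm j := by
    rw [h, submatrix_mul_equiv, Matrix.mul_one]
    ext i k
    simp [mul_apply, one_apply]
  sqDet_eq_one j := sqDet_one_submatrix (e j)

theorem Iso.exists_inverse (f : Iso A B) : ∃ Ψ : ∀ j, Matrix (B.I j) (A.I j) ℂ,
    (∀ j, Ψ j * f.Φ j = 1) ∧ ∀ j, Ψ (j + 1) * A.d j = B.d j * Ψ j := by
  have hinv := fun j => exists_inverse_of_sqDet_ne_zero (f.Φ j) (by simp [f.sqDet_eq_one])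
  choose Ψ h1 h2 using hinv
  refine ⟨Ψ, h2, fun j => ?_⟩
  calc Ψ (j + 1) * A.d j = Ψ (j + 1) * (A.d j * f.Φ j) * Ψ j := by
        rw [Matrix.mul_assoc, Matrix.mul_assoc (A.d j), h1, Matrix.mul_one]
    _ = B.d j * Ψ j := by
        rw [← f.comm, ← Matrix.mul_assoc, h2, Matrix.one_mul]

theorem Iso.exact (f : Iso A B) (h : A.Exact) : B.Exact := by
  obtain ⟨Ψ, h2, hcomm⟩ := f.exists_inverse
  refine ⟨fun v => ?_, fun j v hv => ?_⟩
  · obtain ⟨u, hu⟩ := h.1 (v ᵥ* Ψ 0)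
    refine ⟨u ᵥ* f.Φ 1, ?_⟩
    rw [vecMul_vecMul, f.comm, ← vecMul_vecMul, hu, vecMul_vecMul, h2, vecMul_one]
  · obtain ⟨u, hu⟩ := h.2 j (v ᵥ* Ψ (j + 1)) (by
      rw [vecMul_vecMul, hcomm, ← vecMul_vecMul, hv, zero_vecMul])
    refine ⟨u ᵥ* f.Φ (j + 2), ?_⟩
    rw [vecMul_vecMul, f.comm, ← vecMul_vecMul, hu, vecMul_vecMul, h2, vecMul_one]

theorem Iso.card_eq (f : Iso A B) (j : ℕ) : Fintype.card (A.I j) = Fintype.card (B.I j) := by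
  by_contra hc
  have := f.sqDet_eq_one j
  rw [sqDet, dif_neg hc] at this
  exact zero_ne_one this

theorem Iso.symm (f : Iso A B) : Nonempty (Iso B A) := by
  obtain ⟨Ψ, h2, hcomm⟩ := f.exists_inverse
  refine ⟨⟨Ψ, hcomm, fun j => ?_⟩⟩
  obtain ⟨e⟩ := Fintype.card_eq.1 (f.card_eq j)
  have := sqDet_mul (Ψ j) (f.Φ j) e.symm e
  rwa [h2, f.sqDet_eq_one, mul_one, sqDet_square, det_one, one_pow, eq_comm] at this

theorem Iso.exact_iff (f : Iso A B) : A.Exact ↔ B.Exact :=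
  ⟨f.exact, f.symm.some.exact⟩

/-- The change of basis in degree `j + 1` is block triangular with diagonal blocks `P (j + 1)` and
`P j`. Each `P j` thus occurs in two adjacent degrees with opposite exponents, and the alternating
product telescopes. With `f` the identity this is independence of the choices. -/
theorem Iso.sqTorsion_eq (f : Iso A B) (s : A.Splitting) (t : B.Splitting) :
    s.sqTorsion = t.sqTorsion := by
  have hcard : ∀ j, Fintype.card (s.R j) = Fintype.card (t.R j) := by
    intro j
    induction j with
    | zero => rw [s.card_zero, t.card_zero, f.card_eq]
    | succ j ih =>
      have h1 := s.card_succ j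
      have h2 := t.card_succ j
      have h3 := f.card_eq (j + 1)
      omega
  have eR := fun j => (Fintype.card_eq.1 (hcard j)).some
  have eI := fun j => (Fintype.card_eq.1 (f.card_eq j)).some
  have es := fun j => (Fintype.card_eq.1 (s.card_sum j)).some
  have et := fun j => (Fintype.card_eq.1 (t.card_sum j)).some
  have hP := fun j => t.exists_mul_B_eq_mul_d j (s.L j * f.Φ (j + 1))
  choose P hP using hP
  have hP' : ∀ j, P j * t.B j = s.B j * f.Φ j := fun j => by
    rw [hP, Matrix.mul_assoc, f.comm, ← Matrix.mul_assoc, s.L_mul_d]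
  -- Both lifts have the same boundary, so their difference is a cycle; its coordinates form the
  -- off-diagonal block.
  have hQ := fun j => t.exists_mul_B_eq j (s.L j * f.Φ (j + 1) - P j * t.L j) (by
    rw [Matrix.sub_mul, ← hP, Matrix.mul_assoc (P j), t.L_mul_d, sub_self])
  choose Q hQ using hQ
  have h0 : s.sq 0 = sqDet (P 0) * t.sq 0 := by
    have e0 := (Fintype.card_eq.1 s.card_zero).some
    have e0' := (Fintype.card_eq.1 t.card_zero).some
    change sqDet _ = _ * sqDet _
    rw [← sqDet_mul _ _ (eR 0) e0', hP', sqDet_mul _ _ e0 (eI 0), f.sqDet_eq_one, mul_one]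
  have h1 : ∀ j, s.sq (j + 1) = sqDet (P (j + 1)) * sqDet (P j) * t.sq (j + 1) := fun j => by
    change sqDet _ = _ * _ * sqDet _
    rw [← sqDet_fromBlocks_zero _ (Q j) _ (eR (j + 1)) (eR j),
      ← sqDet_mul _ _ (Equiv.sumCongr (eR (j + 1)) (eR j)) (et j),
      fromBlocks_mul_fromRows, hP', hQ, Matrix.zero_mul, add_zero, sub_add_cancel,
      ← fromRows_mul, sqDet_mul _ _ (es j) (eI _), f.sqDet_eq_one, mul_one]
  have hPne : ∀ j, sqDet (P j) ≠ 0 := fun j => by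
    cases j with
    | zero => exact fun h => s.sq_ne_zero 0 (by rw [h0, h, zero_mul])
    | succ j => exact fun h => s.sq_ne_zero (j + 1) (by rw [h1, h, zero_mul, zero_mul])
  have key : ∀ N, ∏ j ∈ Finset.range (N + 1), s.sq j ^ ((-1 : ℤ) ^ (j + 1)) =
      sqDet (P N) ^ ((-1 : ℤ) ^ (N + 1)) *
        ∏ j ∈ Finset.range (N + 1), t.sq j ^ ((-1 : ℤ) ^ (j + 1)) := by
    intro N
    induction N with
    | zero => simp [h0, mul_comm]
    | succ N ih =>
      rw [Finset.prod_range_succ, ih, Finset.prod_range_succ _ (N + 1), h1, mul_zpow, mul_zpow,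
        pow_succ _ (N + 1), mul_neg_one, _root_.zpow_neg, _root_.zpow_neg, _root_.zpow_neg]
      have := zpow_ne_zero ((-1 : ℤ) ^ (N + 1)) (hPne N)
      field_simp
  -- At the common top degree there are no further boundaries, so the remaining factor is the
  -- determinant of an empty matrix.
  rw [s.sqTorsion_eq (max A.dim B.dim) (le_max_left _ _),
    t.sqTorsion_eq (max A.dim B.dim) (le_max_right _ _), key]
  have := s.isEmpty_R _ (le_max_left A.dim B.dim)
  have := t.isEmpty_R _ (le_max_right A.dim B.dim)
  rw [sqDet_of_isEmpty, _root_.one_zpow, one_mul]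

/-! ### Direct sums -/

variable (A B) in
/-- The direct sum of two complexes. -/
abbrev sum : MatrixComplex where
  I j := A.I j ⊕ B.I j
  d j := fromBlocks (A.d j) 0 0 (B.d j)
  d_mul_d j := by simp [fromBlocks_multiply, A.d_mul_d, B.d_mul_d]
  dim := max A.dim B.dim
  isEmpty_I j hj := by
    have h₁ := A.isEmpty_I j (lt_of_le_of_lt (le_max_left _ _) hj)
    have h₂ := B.isEmpty_I j (lt_of_le_of_lt (le_max_right _ _) hj)
    infer_instance

theorem exact_of_sum (h : (A.sum B).Exact) : A.Exact := by
  refine ⟨fun v => ?_, fun j v hv => ?_⟩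
  · obtain ⟨u, hu⟩ := h.1 (Sum.elim v 0)
    refine ⟨u ∘ Sum.inl, ?_⟩
    have hu' : u ᵥ* fromBlocks (A.d 0) 0 0 (B.d 0) = Sum.elim v 0 := hu
    rw [vecMul_fromBlocks] at hu'
    simpa using congrArg (fun w => w ∘ Sum.inl) hu'
  · obtain ⟨u, hu⟩ := h.2 j (Sum.elim v 0) (by
      change Sum.elim v 0 ᵥ* fromBlocks (A.d j) 0 0 (B.d j) = 0
      rw [vecMul_fromBlocks]
      simp [hv])
    refine ⟨u ∘ Sum.inl, ?_⟩
    have hu' : u ᵥ* fromBlocks (A.d (j + 1)) 0 0 (B.d (j + 1)) = Sum.elim v 0 := hu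
    rw [vecMul_fromBlocks] at hu'
    simpa using congrArg (fun w => w ∘ Sum.inl) hu'

/-- The direct sum of splittings. -/
abbrev Splitting.sum (s : A.Splitting) (t : B.Splitting) : (A.sum B).Splitting where
  R j := s.R j ⊕ t.R j
  B j := fromBlocks (s.B j) 0 0 (t.B j)
  L j := fromBlocks (s.L j) 0 0 (t.L j)
  L_mul_d j := by
    change fromBlocks _ 0 0 _ * fromBlocks _ 0 0 _ = _
    simp [fromBlocks_multiply, s.L_mul_d, t.L_mul_d]
  span j u := by
    obtain ⟨v, hv⟩ := s.span j (u ∘ Sum.inl)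
    obtain ⟨w, hw⟩ := t.span j (u ∘ Sum.inr)
    refine ⟨Sum.elim v w, ?_⟩
    change _ ᵥ* fromBlocks (s.B j) 0 0 (t.B j) = u ᵥ* fromBlocks (A.d j) 0 0 (B.d j)
    rw [vecMul_fromBlocks, vecMul_fromBlocks]
    simp [hv, hw]
  indep j v hv := by
    change _ ᵥ* fromBlocks (s.B j) 0 0 (t.B j) = 0 at hv
    rw [vecMul_fromBlocks] at hv
    have h1 := s.indep j (v ∘ Sum.inl) (by simpa using congrArg (fun w => w ∘ Sum.inl) hv)
    have h2 := t.indep j (v ∘ Sum.inr) (by simpa using congrArg (fun w => w ∘ Sum.inr) hv)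
    ext (i | i)
    · exact congrFun h1 i
    · exact congrFun h2 i
  card_zero := by
    change _ = Fintype.card (A.I 0 ⊕ B.I 0)
    rw [Fintype.card_sum, Fintype.card_sum, s.card_zero, t.card_zero]
  card_succ j := by
    change _ = Fintype.card (A.I (j + 1) ⊕ B.I (j + 1))
    rw [Fintype.card_sum, Fintype.card_sum, Fintype.card_sum, ← s.card_succ, ← t.card_succ]
    omega

theorem Splitting.sq_sum (s : A.Splitting) (t : B.Splitting) (j : ℕ) :
    (s.sum t).sq j = s.sq j * t.sq j := by
  cases j with
  | zero =>
    exact sqDet_fromBlocks_zero _ _ _ (Fintype.card_eq.1 s.card_zero).some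
      (Fintype.card_eq.1 t.card_zero).some
  | succ j =>
    change sqDet _ = sqDet _ * sqDet _
    rw [← sqDet_fromBlocks_zero _ 0 _ (Fintype.card_eq.1 (s.card_sum j)).some
      (Fintype.card_eq.1 (t.card_sum j)).some,
      ← sqDet_submatrix (fromBlocks _ _ _ _) (Equiv.sumSumSumComm _ _ _ _) (Equiv.refl _)]
    congr 1
    ext ((i | i) | (i | i)) (k | k) <;> rfl

theorem Splitting.sqTorsion_sum (s : A.Splitting) (t : B.Splitting) :
    (s.sum t).sqTorsion = s.sqTorsion * t.sqTorsion := by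
  rw [s.sqTorsion_eq (max A.dim B.dim) (le_max_left _ _),
    t.sqTorsion_eq (max A.dim B.dim) (le_max_right _ _), ← Finset.prod_mul_distrib,
    (s.sum t).sqTorsion_eq (max A.dim B.dim) le_rfl]
  simp only [Splitting.sq_sum, mul_zpow]

end MatrixComplex


/-! ### Twisting by `ρ`: from complexes over `ℤ[G]` to complexes over `ℂ`. -/

namespace BasedComplex

variable {G : Type} [Group G] {n : ℕ} (ρ : G →* Matrix.SpecialLinearGroup (Fin n) ℂ)

section twist

variable {I J K : Type} [Fintype I] [DecidableEq I] [Fintype J] [DecidableEq J]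
  [Fintype K] [DecidableEq K]

/-- The block matrix over `ℂ` obtained from a matrix over `ℤ[G]`. -/
def twistMatrix (M : Matrix I J (MonoidAlgebra ℤ G)) : Matrix (I × Fin n) (J × Fin n) ℂ :=
  Matrix.of fun s t => groupRingHom ρ (M s.1 t.1) s.2 t.2

theorem twistMatrix_apply (M : Matrix I J (MonoidAlgebra ℤ G)) (s : I × Fin n) (t : J × Fin n) :
    twistMatrix ρ M s t = groupRingHom ρ (M s.1 t.1) s.2 t.2 := rfl

theorem twistMatrix_mul (M : Matrix I J (MonoidAlgebra ℤ G)) (N : Matrix J K (MonoidAlgebra ℤ G)) :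
    twistMatrix ρ (M * N) = twistMatrix ρ M * twistMatrix ρ N := by
  ext s t
  simp only [twistMatrix_apply, Matrix.mul_apply, map_sum, map_mul, Matrix.sum_apply,
    Fintype.sum_prod_type]

theorem twistMatrix_zero : twistMatrix ρ (0 : Matrix I J (MonoidAlgebra ℤ G)) = 0 := by
  ext s t
  simp [twistMatrix_apply]

theorem twistMatrix_one : twistMatrix ρ (1 : Matrix I I (MonoidAlgebra ℤ G)) = 1 := by
  ext ⟨s, a⟩ ⟨t, b⟩
  by_cases h : s = t
  · subst h
    simp [twistMatrix_apply, Matrix.one_apply]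
  · simp [twistMatrix_apply, h]

theorem twistMatrix_add (M N : Matrix I J (MonoidAlgebra ℤ G)) :
    twistMatrix ρ (M + N) = twistMatrix ρ M + twistMatrix ρ N := by
  ext s t
  simp [twistMatrix_apply]

/-- The off-diagonal block factors as `U * V` through `ℂⁿ` with `V * U = 0` because `i ≠ k`; now use
`det (1 + U V) = det (1 + V U)`. -/
theorem det_twistMatrix_transvection (i k : I) (a : MonoidAlgebra ℤ G) (h : i ≠ k) :
    (twistMatrix ρ (1 + Matrix.single i k a)).det = 1 := by
  let U : Matrix (I × Fin n) (Fin n) ℂ :=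
    Matrix.of fun s c => if s.1 = i then groupRingHom ρ a s.2 c else 0
  let V : Matrix (Fin n) (I × Fin n) ℂ := Matrix.of fun c t => if t = (k, c) then 1 else 0
  have hUV : twistMatrix ρ (Matrix.single i k a) = U * V := by
    ext ⟨s, c⟩ ⟨t, d⟩
    by_cases hs : s = i
    · by_cases ht : t = k
      · subst hs ht
        simp [U, V, Matrix.mul_apply, twistMatrix_apply]
      · simp [U, V, Matrix.mul_apply, twistMatrix_apply, ht, Ne.symm ht]
    · simp [U, V, Matrix.mul_apply, twistMatrix_apply, hs, Ne.symm hs]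
  have hVU : V * U = 0 := by
    ext c d
    simp only [U, V, Matrix.mul_apply, of_apply, ite_mul, one_mul, zero_mul, Matrix.zero_apply]
    refine Finset.sum_eq_zero fun x _ => ?_
    rw [ite_eq_right_iff]
    rintro rfl
    rw [if_neg (Ne.symm h)]
  rw [twistMatrix_add, twistMatrix_one, hUV, Matrix.det_one_add_mul_comm, hVU, add_zero, det_one]

/-- The only nontrivial block is `±ρ(g)`, of determinant `±1` since `ρ` takes values in `SL_n`; the
sign `(-1)^n` is lost on squaring. -/
theorem det_twistMatrix_diagonal_sq (i : I) (ε : ℤˣ) (g : G) :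
    (twistMatrix ρ (Matrix.diagonal
      (Function.update 1 i (MonoidAlgebra.single g (ε : ℤ))))).det ^ 2 = 1 := by
  let f : I → Matrix (Fin n) (Fin n) ℂ := fun k =>
    groupRingHom ρ ((Function.update 1 i (MonoidAlgebra.single g (ε : ℤ)) :
      I → MonoidAlgebra ℤ G) k)
  have h1 : twistMatrix ρ (Matrix.diagonal
      (Function.update 1 i (MonoidAlgebra.single g (ε : ℤ)))) =
      (Matrix.blockDiagonal f).submatrix (Equiv.prodComm _ _) (Equiv.prodComm _ _) := by
    ext ⟨s, c⟩ ⟨t, d⟩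
    by_cases h : s = t
    · subst h
      simp [f, twistMatrix_apply, Matrix.blockDiagonal_apply]
    · simp [twistMatrix_apply, Matrix.blockDiagonal_apply, h]
  have h2 : ∀ k, (f k).det ^ 2 = 1 := fun k => by
    by_cases hk : k = i
    · subst hk
      have : f k = (ε : ℤ) • (ρ g : Matrix (Fin n) (Fin n) ℂ) := by
        simp [f, groupRingHom, MonoidAlgebra.lift_single]
      rw [this]
      rcases Int.units_eq_one_or ε with h | h <;> simp [h, Matrix.det_neg, ← pow_mul]
    · simp [f, hk]
  rw [h1, det_submatrix_equiv_self, det_blockDiagonal, ← Finset.prod_pow]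
  exact Finset.prod_eq_one fun k _ => h2 k

theorem det_twistMatrix_sq_of_mem_simpleMatrices (M : Matrix I I (MonoidAlgebra ℤ G))
    (hM : M ∈ simpleMatrices G I) : (twistMatrix ρ M).det ^ 2 = 1 := by
  induction hM using Submonoid.closure_induction with
  | mem M hM =>
    rcases hM with ⟨i, k, a, h, rfl⟩ | ⟨i, ε, g, rfl⟩
    · rw [det_twistMatrix_transvection ρ i k a h, one_pow]
    · exact det_twistMatrix_diagonal_sq ρ i ε g
  | one => rw [twistMatrix_one, det_one, one_pow]
  | mul M N _ _ hM hN => rw [twistMatrix_mul, det_mul, mul_pow, hM, hN, one_mul]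

end twist

variable (C D : BasedComplex G)

/-- The twisted chain complex as a complex of matrices. -/
abbrev twist : MatrixComplex where
  I j := C.cell j × Fin n
  d j := twistMatrix ρ (C.bd j)
  d_mul_d j := by rw [← twistMatrix_mul, C.bd_comp_bd, twistMatrix_zero]
  dim := C.dim
  isEmpty_I j hj := by
    have := C.isEmpty_cell j hj
    infer_instance

theorem twistedBd_apply (j : ℕ) (v : C.Chain n (j + 1)) :
    C.twistedBd ρ j v = v ᵥ* (C.twist ρ).d j := rfl

theorem twistedBd_comp (j : ℕ) (v : C.Chain n (j + 2)) :
    C.twistedBd ρ j (C.twistedBd ρ (j + 1) v) = 0 := by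
  rw [twistedBd_apply, twistedBd_apply, vecMul_vecMul, (C.twist ρ).d_mul_d, vecMul_zero]

theorem acyclic_iff_exact : C.Acyclic ρ ↔ (C.twist ρ).Exact := by
  refine and_congr ?_ (forall_congr' fun j => ?_)
  · rw [LinearMap.range_eq_top]
    rfl
  · constructor
    · intro h v hv
      exact h.le (LinearMap.mem_ker.2 hv)
    · intro h
      refine le_antisymm (fun v hv => h v hv) ?_
      rintro _ ⟨u, rfl⟩
      exact C.twistedBd_comp ρ j u

theorem finrank_range_zero (h : C.Acyclic ρ) :
    Module.finrank ℂ (LinearMap.range (C.twistedBd ρ 0)) = Fintype.card (C.cell 0 × Fin n) := by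
  rw [h.1, finrank_top, Module.finrank_fintype_fun_eq_card]

theorem finrank_range_succ (h : C.Acyclic ρ) (j : ℕ) :
    Module.finrank ℂ (LinearMap.range (C.twistedBd ρ (j + 1))) +
      Module.finrank ℂ (LinearMap.range (C.twistedBd ρ j)) =
      Fintype.card (C.cell (j + 1) × Fin n) := by
  rw [← h.2 j, add_comm, LinearMap.finrank_range_add_finrank_ker,
    Module.finrank_fintype_fun_eq_card]

theorem Acyclic.exists_torsionChoice {C : BasedComplex G} {ρ : G →* Matrix.SpecialLinearGroup (Fin n) ℂ}
    (h : C.Acyclic ρ) : Nonempty (C.TorsionChoice ρ) := by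
  let b := fun j => Module.finBasis ℂ (LinearMap.range (C.twistedBd ρ j))
  have hl : ∀ j i, ∃ u, C.twistedBd ρ j u = (b j i : C.Chain n j) := fun j i => (b j i).2
  choose l hl using hl
  exact ⟨{
    r := fun j => Module.finrank ℂ (LinearMap.range (C.twistedBd ρ j))
    b := b
    lift := l
    twistedBd_lift := hl
    enumZero := Fintype.equivOfCardEq (by rw [Fintype.card_fin, C.finrank_range_zero ρ h])
    enumSucc := fun j => Fintype.equivOfCardEq (by
      rw [Fintype.card_sum, Fintype.card_fin, Fintype.card_fin, C.finrank_range_succ ρ h]) }⟩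

variable {C ρ}

/-- The choices in the definition of the torsion, as matrices. -/
abbrev TorsionChoice.splitting (c : C.TorsionChoice ρ) : (C.twist ρ).Splitting where
  R j := Fin (c.r j)
  B j := Matrix.of fun i => (c.b j i : C.Chain n j)
  L j := Matrix.of (c.lift j)
  L_mul_d j := by
    ext i k
    exact congrFun (c.twistedBd_lift j i) k
  span j u := by
    let w : LinearMap.range (C.twistedBd ρ j) := ⟨u ᵥ* (C.twist ρ).d j, u, rfl⟩
    refine ⟨(c.b j).repr w, ?_⟩
    have h := congrArg (Subtype.val) ((c.b j).sum_repr w)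
    rw [Submodule.coe_sum] at h
    rw [Matrix.vecMul_eq_sum]
    exact h
  indep j v hv := by
    rw [Matrix.vecMul_eq_sum] at hv
    have h : ∑ i, v i • c.b j i = 0 := Subtype.ext (by
      rw [Submodule.coe_sum]
      exact hv)
    ext i
    exact Fintype.linearIndependent_iff.1 (c.b j).linearIndependent v h i
  card_zero := (Fintype.card_congr c.enumZero).symm
  card_succ j := by
    rw [← Fintype.card_sum]
    exact (Fintype.card_congr (c.enumSucc j)).symm

theorem TorsionChoice.splitting_sq (c : C.TorsionChoice ρ) (j : ℕ) :
    c.splitting.sq j = (Matrix.of (c.family j)).det ^ 2 := by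
  cases j with
  | zero => exact sqDet_eq _ c.enumZero (Equiv.refl _)
  | succ j =>
    refine (sqDet_eq _ (c.enumSucc j) (Equiv.refl _)).trans ?_
    congr 2

theorem TorsionChoice.splitting_sqTorsion (c : C.TorsionChoice ρ) :
    c.splitting.sqTorsion = c.value ^ 2 := by
  rw [MatrixComplex.Splitting.sqTorsion, TorsionChoice.value, ← Finset.prod_pow]
  refine Finset.prod_congr rfl fun j _ => ?_
  rw [c.splitting_sq, ← zpow_natCast, ← _root_.zpow_mul, ← zpow_natCast, ← _root_.zpow_mul, mul_comm]

/-! ### Invariance under simple equivalence -/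

variable (C ρ)

/-- Twisting commutes with direct sums. -/
def twistDirectSum : MatrixComplex.Iso ((C.directSum D).twist ρ) ((C.twist ρ).sum (D.twist ρ)) :=
  MatrixComplex.Iso.ofEquiv (fun _ => Equiv.sumProdDistrib _ _ _) fun j => by
    ext ⟨s | s, a⟩ ⟨t | t, b⟩
    · rfl
    · exact congrFun (congrFun (map_zero (groupRingHom ρ)) a) b
    · exact congrFun (congrFun (map_zero (groupRingHom ρ)) a) b
    · rfl

variable {C D}

theorem SimpleIso.twist (h : SimpleIso C D) : Nonempty (MatrixComplex.Iso (C.twist ρ) (D.twist ρ)) := by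
  obtain ⟨f, hf, hcomm⟩ := h
  refine ⟨⟨fun j => twistMatrix ρ (f j), fun j => ?_, fun j => ?_⟩⟩
  · change twistMatrix ρ _ * twistMatrix ρ _ = twistMatrix ρ _ * twistMatrix ρ _
    rw [← twistMatrix_mul, hcomm, twistMatrix_mul]
  · obtain ⟨σ, M, hM, hfM⟩ := hf j
    have h1 : twistMatrix ρ (f j) = (twistMatrix ρ M).submatrix (Equiv.refl _)
        (σ.symm.prodCongr (Equiv.refl (Fin n))) := by
      rw [hfM]; rfl
    rw [h1, sqDet_submatrix, sqDet_square, det_twistMatrix_sq_of_mem_simpleMatrices ρ M hM]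

theorem SimpleIso.refl (C : BasedComplex G) : SimpleIso C C :=
  ⟨fun _ => 1, fun _ => ⟨Equiv.refl _, 1, one_mem _, rfl⟩, fun _ => by
    rw [Matrix.one_mul, Matrix.mul_one]⟩

theorem SimpleEquiv.refl (C : BasedComplex G) : SimpleEquiv C C :=
  ⟨0, 0, Fin.elim0, Fin.elim0, SimpleIso.refl _⟩

/-- The `0`-cells of a trivial complex. -/
def trivialEnumZero {m : ℕ} (d : Fin m → ℕ) :
    {s : Fin m // d s = 0} × Fin n ≃ ({s : Fin m // d s = 0} ⊕ {s : Fin m // d s + 1 = 0}) × Fin n :=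
  haveI : IsEmpty {s : Fin m // d s + 1 = 0} := ⟨fun s => Nat.succ_ne_zero _ s.2⟩
  (Equiv.sumEmpty _ _).symm.prodCongr (Equiv.refl _)

/-- The cells of positive dimension of a trivial complex. -/
def trivialEnumSucc {m : ℕ} (d : Fin m → ℕ) (j : ℕ) :
    {s : Fin m // d s = j + 1} × Fin n ⊕ {s : Fin m // d s = j} × Fin n ≃
      ({s : Fin m // d s = j + 1} ⊕ {s : Fin m // d s + 1 = j + 1}) × Fin n :=
  (Equiv.sumProdDistrib _ _ _).symm.trans
    ((Equiv.sumCongr (Equiv.refl _)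
      (Equiv.subtypeEquivRight fun _ => Nat.succ_inj.symm)).prodCongr (Equiv.refl _))

theorem twistMatrix_trivialPairs_inr {m : ℕ} (d : Fin m → ℕ) (j : ℕ) (s : {s : Fin m // d s + 1 = j + 1})
    (t : (trivialPairs G d).cell j) (a b : Fin n) :
    twistMatrix ρ ((trivialPairs G d).bd j) (Sum.inr s, a) (t, b) =
      (1 : Matrix ((trivialPairs G d).cell j × Fin n) ((trivialPairs G d).cell j × Fin n) ℂ)
        (Sum.inl ⟨s.1, Nat.succ_inj.1 s.2⟩, a) (t, b) := by
  rcases t with t | t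
  · by_cases h : s.1 = t.1
    · have ht : t = ⟨s.1, Nat.succ_inj.1 s.2⟩ := Subtype.ext h.symm
      subst ht
      simp [twistMatrix_apply, trivialPairs, Matrix.one_apply]
    · have ht : (⟨s.1, Nat.succ_inj.1 s.2⟩ : {s : Fin m // d s = j}) ≠ t :=
        fun h' => h (congrArg Subtype.val h')
      rw [one_apply_ne fun h' => ht (Sum.inl_injective (congrArg Prod.fst h'))]
      simp [twistMatrix_apply, trivialPairs, h]
  · rw [one_apply_ne fun h' => Sum.inl_ne_inr (congrArg Prod.fst h')]
    simp [twistMatrix_apply, trivialPairs]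

theorem twistMatrix_trivialPairs_col {m : ℕ} (d : Fin m → ℕ) (j : ℕ)
    (s : (trivialPairs G d).cell (j + 1))
    (t : {s : Fin m // d s + 1 = j}) (a b : Fin n) :
    twistMatrix ρ ((trivialPairs G d).bd j) (s, a) (Sum.inr t, b) = 0 := by
  rcases s with s | s <;> simp [twistMatrix_apply, trivialPairs]

/-- The obvious splitting of a trivial complex. -/
abbrev trivialSplitting {m : ℕ} (d : Fin m → ℕ) : ((trivialPairs G d).twist ρ).Splitting where
  R j := {s : Fin m // d s = j} × Fin n
  B j := (1 : Matrix ((trivialPairs G d).cell j × Fin n) ((trivialPairs G d).cell j × Fin n) ℂ).submatrix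
    (fun s => (Sum.inl s.1, s.2)) id
  L j := (1 : Matrix ((trivialPairs G d).cell (j + 1) × Fin n)
      ((trivialPairs G d).cell (j + 1) × Fin n) ℂ).submatrix
    (fun s => (Sum.inr ⟨s.1.1, congrArg (· + 1) s.1.2⟩, s.2)) id
  L_mul_d j := by
    ext ⟨s, a⟩ ⟨t, b⟩
    rw [mul_apply]
    simp only [submatrix_apply, id_eq, one_apply, ite_mul, one_mul, zero_mul, Finset.sum_ite_eq,
      Finset.mem_univ, if_true]
    exact twistMatrix_trivialPairs_inr ρ d j _ t a b
  span j u := by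
    refine ⟨fun s => (u ᵥ* twistMatrix ρ ((trivialPairs G d).bd j)) (Sum.inl s.1, s.2), ?_⟩
    ext ⟨t | t, b⟩
    · rw [vecMul, dotProduct, Finset.sum_eq_single (t, b)]
      · rw [submatrix_apply, id_eq, one_apply_eq, mul_one]
      · rintro ⟨s, a⟩ - h
        rw [submatrix_apply, one_apply_ne (fun h' => h (by cases h'; rfl)), mul_zero]
      · simp
    · rw [vecMul, dotProduct, vecMul, dotProduct, Finset.sum_eq_zero, Finset.sum_eq_zero]
      · rintro ⟨s, a⟩ -
        exact mul_eq_zero_of_right _ (twistMatrix_trivialPairs_col ρ d j s t a b)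
      · rintro ⟨s, a⟩ -
        rw [submatrix_apply, one_apply_ne (fun h' => by cases h'), mul_zero]
  indep j v hv := by
    ext ⟨t, b⟩
    have h := congrFun hv (Sum.inl t, b)
    rw [vecMul, dotProduct, Finset.sum_eq_single (t, b)] at h
    · rwa [submatrix_apply, id_eq, one_apply_eq, mul_one] at h
    · rintro ⟨s, a⟩ - h
      rw [submatrix_apply, one_apply_ne (fun h' => h (by cases h'; rfl)), mul_zero]
    · simp
  card_zero := Fintype.card_congr (trivialEnumZero d)
  card_succ j := by
    rw [← Fintype.card_sum]
    exact Fintype.card_congr (trivialEnumSucc d j)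

/-- The chosen bases and lifts together just enumerate the standard basis. -/
theorem trivialSplitting_sq {m : ℕ} (d : Fin m → ℕ) (j : ℕ) :
    (trivialSplitting (G := G) ρ d).sq j = 1 := by
  cases j with
  | zero =>
    refine Eq.trans (congrArg sqDet ?_) (sqDet_one_submatrix (trivialEnumZero d))
    ext ⟨s, a⟩ t
    rfl
  | succ j =>
    refine Eq.trans (congrArg sqDet ?_) (sqDet_one_submatrix (trivialEnumSucc d j))
    ext (⟨s, a⟩ | ⟨s, a⟩) t <;> rfl

theorem trivialSplitting_sqTorsion {m : ℕ} (d : Fin m → ℕ) :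
    (trivialSplitting (G := G) ρ d).sqTorsion = 1 :=
  Finset.prod_eq_one fun j _ => by rw [trivialSplitting_sq, _root_.one_zpow]

theorem SimpleEquiv.acyclic_iff (h : SimpleEquiv C D) : C.Acyclic ρ ↔ D.Acyclic ρ := by
  obtain ⟨m, m', d, d', h⟩ := h
  obtain ⟨f⟩ := h.twist ρ
  rw [acyclic_iff_exact, acyclic_iff_exact]
  -- Adding cancelling pairs does not affect exactness: a splitting of `C` plus the obvious one of
  -- the pairs splits the sum, and having a splitting forces exactness.
  have key : ∀ (C : BasedComplex G) (k : ℕ) (e : Fin k → ℕ), (C.twist ρ).Exact ↔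
      ((C.directSum (trivialPairs G e)).twist ρ).Exact := fun C k e => by
    rw [(twistDirectSum ρ C (trivialPairs G e)).exact_iff]
    refine ⟨fun h => ?_, MatrixComplex.exact_of_sum⟩
    obtain ⟨c⟩ := ((acyclic_iff_exact ρ C).2 h).exists_torsionChoice
    exact (c.splitting.sum (trivialSplitting ρ e)).exact
  rw [key C m d, key D m' d', f.exact_iff]

theorem SimpleEquiv.sqTorsion_eq (h : SimpleEquiv C D) (s : (C.twist ρ).Splitting)
    (t : (D.twist ρ).Splitting) : s.sqTorsion = t.sqTorsion := by
  obtain ⟨m, m', d, d', h⟩ := h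
  obtain ⟨f⟩ := h.twist ρ
  have f₁ := twistDirectSum ρ C (trivialPairs G d)
  have f₂ := twistDirectSum ρ D (trivialPairs G d')
  have key : ∀ A : BasedComplex G, (A.twist ρ).Exact → Nonempty (A.twist ρ).Splitting :=
    fun A hA => ((acyclic_iff_exact ρ A).2 hA).exists_torsionChoice.map fun c => c.splitting
  obtain ⟨u⟩ := key _ (f₁.exact_iff.2 (s.sum (trivialSplitting ρ d)).exact)
  obtain ⟨v⟩ := key _ (f₂.exact_iff.2 (t.sum (trivialSplitting ρ d')).exact)
  have h₁ := f₁.sqTorsion_eq u (s.sum (trivialSplitting ρ d))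
  have h₂ := f₂.sqTorsion_eq v (t.sum (trivialSplitting ρ d'))
  rw [s.sqTorsion_sum, trivialSplitting_sqTorsion, mul_one] at h₁
  rw [t.sqTorsion_sum, trivialSplitting_sqTorsion, mul_one] at h₂
  rw [← h₁, ← h₂, f.sqTorsion_eq u v]

theorem isTorsion_zero_of_not_acyclic (h : SimpleEquiv C D) (hD : ¬ D.Acyclic ρ) (z : ℂ) :
    C.IsTorsion ρ z ↔ z = 0 := by
  rw [← h.acyclic_iff ρ] at hD
  simp [IsTorsion, hD]

/-- The sign ambiguity of the torsion is exactly that of a square root, so one splitting of one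
representative `D` decides which numbers are torsions of `C`. -/
theorem sq_eq_of_isTorsion (h : SimpleEquiv C D) (t : (D.twist ρ).Splitting) (z : ℂ) :
    C.IsTorsion ρ z ↔ z ^ 2 = t.sqTorsion := by
  have hD : D.Acyclic ρ := (acyclic_iff_exact ρ D).2 t.exact
  rw [← h.acyclic_iff ρ] at hD
  have hval : ∀ c : C.TorsionChoice ρ, c.value ^ 2 = t.sqTorsion := fun c => by
    rw [← c.splitting_sqTorsion, h.sqTorsion_eq ρ c.splitting t]
  simp only [IsTorsion, hD, not_true_eq_false, false_and, or_false, true_and]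
  constructor
  · rintro ⟨c, hc⟩
    rw [← hval c, sq_eq_sq_iff_eq_or_eq_neg]
    exact hc
  · intro hz
    obtain ⟨c⟩ := hD.exists_torsionChoice
    exact ⟨c, by rwa [← hval c, sq_eq_sq_iff_eq_or_eq_neg] at hz⟩

end BasedComplex


/-! ### The torsion of the torus knot exterior as one determinant. -/

namespace TorusKnotGroup

open BasedComplex

variable {p q n : ℕ} (ρ : TorusKnotGroup p q →* Matrix.SpecialLinearGroup (Fin n) ℂ)

/-- The matrix of the generator `x`. -/
def matX : Matrix (Fin n) (Fin n) ℂ := ρ (x p q)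

/-- The matrix of the generator `y`. -/
def matY : Matrix (Fin n) (Fin n) ℂ := ρ (y p q)

theorem _root_.BasedComplex.groupRingHom_of {G : Type} [Group G]
    (ρ : G →* Matrix.SpecialLinearGroup (Fin n) ℂ) (g : G) :
    groupRingHom ρ (MonoidAlgebra.of ℤ G g) = (ρ g : Matrix (Fin n) (Fin n) ℂ) := by
  simp [groupRingHom]

theorem groupRingHom_sum_x (k : ℕ) :
    groupRingHom ρ (∑ i ∈ Finset.range k, MonoidAlgebra.of ℤ _ (x p q ^ i)) =
      ∑ i ∈ Finset.range k, matX ρ ^ i := by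
  rw [map_sum]
  refine Finset.sum_congr rfl fun i _ => ?_
  rw [groupRingHom_of, map_pow]
  simp [matX]

theorem groupRingHom_sum_y (k : ℕ) :
    groupRingHom ρ (∑ i ∈ Finset.range k, MonoidAlgebra.of ℤ _ (y p q ^ i)) =
      ∑ i ∈ Finset.range k, matY ρ ^ i := by
  rw [map_sum]
  refine Finset.sum_congr rfl fun i _ => ?_
  rw [groupRingHom_of, map_pow]
  simp [matY]

/-- Two copies of `Fin n`. -/
def finTwoProdEquiv (n : ℕ) : Fin n ⊕ Fin n ≃ Fin 2 × Fin n where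
  toFun := Sum.elim (fun i => (0, i)) (fun i => (1, i))
  invFun s := if s.1 = 0 then Sum.inl s.2 else Sum.inr s.2
  left_inv s := by rcases s with s | s <;> simp
  right_inv s := by
    obtain ⟨i, k⟩ := s
    fin_cases i <;> simp

/-- One copy of `Fin n`. -/
def finOneProdEquiv (n : ℕ) : Fin n ≃ Fin 1 × Fin n where
  toFun i := (0, i)
  invFun s := s.2
  left_inv _ := rfl
  right_inv _ := Prod.ext (Subsingleton.elim _ _) rfl

/-- A row of two blocks. -/
def blockRow (U V : Matrix (Fin n) (Fin n) ℂ) : Matrix (Fin 1 × Fin n) (Fin 2 × Fin n) ℂ :=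
  Matrix.of fun s t => (![U, V] t.1) s.2 t.2

/-- The first twisted boundary matrix. -/
def bdZero : Matrix (Fin 2 × Fin n) (Fin 1 × Fin n) ℂ := twistMatrix ρ (torusKnotBd p q 0)

/-- The second twisted boundary matrix. -/
def bdOne : Matrix (Fin 1 × Fin n) (Fin 2 × Fin n) ℂ := twistMatrix ρ (torusKnotBd p q 1)

theorem bdOne_eq :
    bdOne ρ = blockRow (∑ i ∈ Finset.range p, matX ρ ^ i) (-∑ i ∈ Finset.range q, matY ρ ^ i) := by
  ext ⟨s, a⟩ ⟨t, b⟩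
  have hs : s = 0 := Subsingleton.elim _ _
  subst hs
  rw [← groupRingHom_sum_x, ← groupRingHom_sum_y, ← map_neg]
  fin_cases t <;> rfl

theorem bdZero_apply (s : Fin 2) (t : Fin 1) (a b : Fin n) :
    bdZero ρ (s, a) (t, b) = (![matX ρ - 1, matY ρ - 1] s) a b := by
  have ht : t = 0 := Subsingleton.elim _ _
  subst ht
  have hX : groupRingHom ρ (MonoidAlgebra.of ℤ _ (x p q) - 1) = matX ρ - 1 := by
    rw [map_sub, groupRingHom_of, map_one]; rfl
  have hY : groupRingHom ρ (MonoidAlgebra.of ℤ _ (y p q) - 1) = matY ρ - 1 := by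
    rw [map_sub, groupRingHom_of, map_one]; rfl
  rw [← hX, ← hY]
  fin_cases s <;> rfl

theorem blockRow_mul_bdZero (U V : Matrix (Fin n) (Fin n) ℂ)
    (h : U * (matX ρ - 1) + V * (matY ρ - 1) = 1) :
    blockRow U V * bdZero ρ = 1 := by
  ext ⟨s, a⟩ ⟨t, b⟩
  have hst : s = t := Subsingleton.elim _ _
  subst hst
  have h2 := congrFun (congrFun h a) b
  rw [Matrix.add_apply, Matrix.mul_apply, Matrix.mul_apply] at h2
  rw [Matrix.mul_apply, Fintype.sum_prod_type, Fin.sum_univ_two]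
  simp only [bdZero_apply]
  refine h2.trans ?_
  by_cases hab : a = b
  · subst hab
    rw [one_apply_eq, one_apply_eq]
  · rw [one_apply_ne hab, one_apply_ne fun h => hab (congrArg Prod.snd h)]

/-- The ranks of the boundary maps, divided by `n`. -/
def boundaryRank : ℕ → ℕ
  | 0 => 1
  | 1 => 1
  | _ + 2 => 0

/-- The splitting given by a right inverse of the first boundary map. -/
def splitting (U V : Matrix (Fin n) (Fin n) ℂ) (h : U * (matX ρ - 1) + V * (matY ρ - 1) = 1)
    (hinj : ∀ v, v ᵥ* bdOne ρ = 0 → v = 0) :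
    ((torusKnotExterior p q).twist ρ).Splitting where
  R j := Fin (boundaryRank j) × Fin n
  B
    | 0 => (1 : Matrix (Fin 1 × Fin n) (Fin 1 × Fin n) ℂ)
    | 1 => bdOne ρ
    | _ + 2 => 0
  L
    | 0 => blockRow U V
    | 1 => (1 : Matrix (Fin 1 × Fin n) (Fin 1 × Fin n) ℂ)
    | _ + 2 => 0
  L_mul_d
    | 0 => blockRow_mul_bdZero ρ U V h
    | 1 => Matrix.one_mul (bdOne ρ)
    | _ + 2 => Matrix.zero_mul _
  span
    | 0 => fun u => ⟨u ᵥ* bdZero ρ,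
        vecMul_one (u ᵥ* bdZero ρ)⟩
    | 1 => fun u => ⟨u, rfl⟩
    | _ + 2 => fun u => ⟨0, by
        rw [zero_vecMul, show u = 0 from funext fun i => i.1.elim0, zero_vecMul]⟩
  indep
    | 0 => fun v hv => (vecMul_one v).symm.trans hv
    | 1 => hinj
    | _ + 2 => fun v _ => funext fun i => i.1.elim0
  card_zero := rfl
  card_succ
    | 0 => by
      change Fintype.card (Fin 1 × Fin n) + Fintype.card (Fin 1 × Fin n) =
        Fintype.card (Fin 2 × Fin n)
      simp only [Fintype.card_prod, Fintype.card_fin]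
      ring
    | 1 => by
      change Fintype.card (Fin 0 × Fin n) + Fintype.card (Fin 1 × Fin n) =
        Fintype.card (Fin 1 × Fin n)
      simp only [Fintype.card_prod, Fintype.card_fin]
      ring
    | j + 2 => by
      change Fintype.card (Fin 0 × Fin n) + Fintype.card (Fin 0 × Fin n) =
        Fintype.card (Fin 0 × Fin n)
      simp only [Fintype.card_prod, Fintype.card_fin]
      ring

/-- The matrix whose determinant is the torsion. -/
def torsionMatrix (U V : Matrix (Fin n) (Fin n) ℂ) : Matrix (Fin n ⊕ Fin n) (Fin n ⊕ Fin n) ℂ :=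
  fromBlocks (∑ i ∈ Finset.range p, matX ρ ^ i) (-∑ i ∈ Finset.range q, matY ρ ^ i) U V

theorem sqDet_fromRows (U V : Matrix (Fin n) (Fin n) ℂ) :
    sqDet (fromRows (bdOne ρ) (blockRow U V)) =
      (torsionMatrix ρ U V).det ^ 2 := by
  rw [bdOne_eq]
  refine (sqDet_eq _ (Equiv.sumCongr (finOneProdEquiv n) (finOneProdEquiv n))
    (finTwoProdEquiv n)).trans ?_
  congr 2
  ext (a | a) (b | b) <;> rfl

theorem splitting_sqTorsion (U V : Matrix (Fin n) (Fin n) ℂ)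
    (h : U * (matX ρ - 1) + V * (matY ρ - 1) = 1)
    (hinj : ∀ v, v ᵥ* bdOne ρ = 0 → v = 0) :
    (splitting ρ U V h hinj).sqTorsion = (torsionMatrix ρ U V).det ^ 2 := by
  have h0 : (splitting ρ U V h hinj).sq 0 = 1 :=
    (sqDet_square (1 : Matrix (Fin 1 × Fin n) (Fin 1 × Fin n) ℂ)).trans (by rw [det_one, one_pow])
  have h1 : (splitting ρ U V h hinj).sq 1 = (torsionMatrix ρ U V).det ^ 2 := sqDet_fromRows ρ U V
  have h2 : (splitting ρ U V h hinj).sq 2 = 1 := by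
    refine (sqDet_eq (fromRows (0 : Matrix (Fin 0 × Fin n) (Fin 1 × Fin n) ℂ)
      (1 : Matrix (Fin 1 × Fin n) (Fin 1 × Fin n) ℂ)) (Equiv.emptySum _ _).symm
      (Equiv.refl _)).trans ?_
    have : (fromRows (0 : Matrix (Fin 0 × Fin n) (Fin 1 × Fin n) ℂ)
      (1 : Matrix (Fin 1 × Fin n) (Fin 1 × Fin n) ℂ)).submatrix (Equiv.emptySum _ _).symm
      (Equiv.refl _) = 1 := rfl
    rw [this, det_one, one_pow]
  -- Degree `1` has exponent `(-1)^2 = 1`, so the determinant itself appears and not its inverse.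
  change ∏ j ∈ Finset.range 3, _ = _
  rw [Finset.prod_range_succ, Finset.prod_range_succ, Finset.prod_range_one, h0, h1, h2]
  norm_num

/-- Given `U` and `V`, injectivity of the second boundary map is all that acyclicity still needs. If
it fails, a kernel vector makes the determinant vanish too, in agreement with the convention that
the torsion is then `0`. -/
theorem isReidemeisterTorsion_iff (U V : Matrix (Fin n) (Fin n) ℂ)
    (h : U * (matX ρ - 1) + V * (matY ρ - 1) = 1) (z : ℂ) :
    IsReidemeisterTorsion p q ρ z ↔ z ^ 2 = (torsionMatrix ρ U V).det ^ 2 := by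
  by_cases hinj : ∀ v, v ᵥ* bdOne ρ = 0 → v = 0
  · rw [← splitting_sqTorsion ρ U V h hinj]
    exact ⟨fun ⟨_, hC, hz⟩ => (sq_eq_of_isTorsion ρ hC _ z).1 hz,
      fun hz => ⟨_, SimpleEquiv.refl _, (sq_eq_of_isTorsion ρ (SimpleEquiv.refl _) _ z).2 hz⟩⟩
  · have hac : ¬ (torusKnotExterior p q).Acyclic ρ := by
      rw [acyclic_iff_exact]
      refine fun hex => hinj fun v hv => ?_
      obtain ⟨u, rfl⟩ := hex.2 1 v hv
      have hu : u = 0 := funext fun i => i.1.elim0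
      subst hu
      exact zero_vecMul _
    have hdet : (torsionMatrix ρ U V).det ^ 2 = 0 := by
      by_contra hne
      rw [← sqDet_fromRows] at hne
      obtain ⟨N, hN, -⟩ := exists_inverse_of_sqDet_ne_zero _ hne
      refine hinj fun v hv => ?_
      -- A kernel vector of the upper rows, extended by zero, is a kernel vector of the full matrix.
      have h1 : Sum.elim v 0 ᵥ* (fromRows (bdOne ρ) (blockRow U V)) = 0 := by
        rw [vecMul_fromRows, Sum.elim_comp_inl, Sum.elim_comp_inr, zero_vecMul, add_zero]
        exact hv
      have h2 := congrArg (fun w => w ᵥ* N) h1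
      simp only [vecMul_vecMul, hN, vecMul_one, zero_vecMul] at h2
      exact funext fun i => congrFun h2 (Sum.inl i)
    rw [hdet, sq_eq_zero_iff]
    exact ⟨fun ⟨_, hC, hz⟩ => (isTorsion_zero_of_not_acyclic ρ hC hac z).1 hz,
      fun hz => ⟨_, SimpleEquiv.refl _,
        (isTorsion_zero_of_not_acyclic ρ (SimpleEquiv.refl _) hac z).2 hz⟩⟩

/-- The torsion of a trivial representation vanishes. -/
theorem isReidemeisterTorsion_trivial [NeZero n] (hX : matX ρ = 1) (hY : matY ρ = 1) (z : ℂ) :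
    IsReidemeisterTorsion p q ρ z ↔ z = 0 := by
  have hac : ¬ (torusKnotExterior p q).Acyclic ρ := by
    rw [acyclic_iff_exact]
    intro hex
    obtain ⟨u, hu⟩ := hex.1 fun _ => 1
    have h0 : bdZero ρ = 0 := by
      ext ⟨s, a⟩ ⟨t, b⟩
      rw [bdZero_apply, hX, hY, sub_self]
      fin_cases s <;> rfl
    have h1 := congrFun hu ((0 : Fin 1), (0 : Fin n))
    change ((u : Fin 2 × Fin n → ℂ) ᵥ* bdZero ρ) ((0 : Fin 1), (0 : Fin n)) = 1 at h1
    rw [h0] at h1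
    exact zero_ne_one ((congrFun (vecMul_zero _) _).symm.trans h1)
  exact ⟨fun ⟨_, hC, hz⟩ => (isTorsion_zero_of_not_acyclic ρ hC hac z).1 hz,
    fun hz => ⟨_, SimpleEquiv.refl _,
      (isTorsion_zero_of_not_acyclic ρ (SimpleEquiv.refl _) hac z).2 hz⟩⟩

end TorusKnotGroup


/-! ### Consequences of irreducibility. -/

namespace TorusKnotGroup

variable {p q n : ℕ} {ρ : TorusKnotGroup p q →* Matrix.SpecialLinearGroup (Fin n) ℂ}

theorem _root_.Representation.IsIrreducible.submodule_eq_bot_or_eq_top {k G V : Type*} [Field k] [Monoid G]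
    [AddCommGroup V] [Module k V] {σ : Representation k G V} (h : σ.IsIrreducible)
    (W : Submodule k V) (hW : ∀ g, ∀ w ∈ W, σ g w ∈ W) : W = ⊥ ∨ W = ⊤ := by
  rcases IsSimpleOrder.eq_bot_or_eq_top (⟨W, fun g w => hW g w⟩ : Subrepresentation σ) with h | h
  · exact Or.inl (congrArg Subrepresentation.toSubmodule h)
  · exact Or.inr (congrArg Subrepresentation.toSubmodule h)

theorem pos_of_isIrreducible (hρ : (linearRep ρ).IsIrreducible) : 0 < n := by
  rcases Nat.eq_zero_or_pos n with rfl | h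
  · obtain ⟨A, B, hAB⟩ := hρ.toNontrivial
    exact absurd (Subrepresentation.toSubmodule_injective (Subsingleton.elim _ _)) hAB
  · exact h

/-- The group elements having `w` as an eigenvector form a subgroup. If it contains both generators,
the line through `w` is invariant, which is impossible in dimension at least `2` unless `w = 0`. -/
theorem eq_zero_of_common_eigenvector (hρ : (linearRep ρ).IsIrreducible) (hn : 2 ≤ n)
    {w : Fin n → ℂ} {a b : ℂ} (hX : matX ρ *ᵥ w = a • w) (hY : matY ρ *ᵥ w = b • w) : w = 0 := by
  by_contra hw
  let H : Subgroup (TorusKnotGroup p q) :=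
    { carrier := {g | ∃ c : ℂ, linearRep ρ g w = c • w}
      one_mem' := ⟨1, by simp⟩
      mul_mem' := by
        rintro g h ⟨c, hc⟩ ⟨d, hd⟩
        exact ⟨d * c, by rw [map_mul, Module.End.mul_apply, hd, map_smul, hc, smul_smul]⟩
      inv_mem' := by
        rintro g ⟨c, hc⟩
        have h1 : w = c • linearRep ρ g⁻¹ w := by
          rw [← map_smul, ← hc, ← Module.End.mul_apply, ← map_mul, inv_mul_cancel, map_one,
            Module.End.one_apply]
        have hc0 : c ≠ 0 := by
          rintro rfl
          exact hw (by rw [h1, zero_smul])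
        refine ⟨c⁻¹, ?_⟩
        conv_rhs => rw [h1, smul_smul, inv_mul_cancel₀ hc0, one_smul] }
  have hH : ∀ g, ∃ c : ℂ, linearRep ρ g w = c • w := PresentedGroup.generated_by _ H fun j => by
    fin_cases j
    · exact ⟨a, hX⟩
    · exact ⟨b, hY⟩
  rcases hρ.submodule_eq_bot_or_eq_top (ℂ ∙ w) (fun g v hv => by
    obtain ⟨d, rfl⟩ := Submodule.mem_span_singleton.1 hv
    obtain ⟨c, hc⟩ := hH g
    rw [map_smul, hc, smul_smul]
    exact Submodule.smul_mem _ _ (Submodule.mem_span_singleton_self w)) with h | h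
  · exact hw (Submodule.span_singleton_eq_bot.1 h)
  · have h1 := finrank_span_singleton (K := ℂ) hw
    rw [h, finrank_top, Module.finrank_fin_fun] at h1
    omega

/-- A vector killed by `X - 1` and `Y - 1` is a common eigenvector, hence zero. The stacked matrix
is therefore injective on columns, and the two column blocks of a left inverse are `U` and `V`. -/
theorem exists_right_inverse (hρ : (linearRep ρ).IsIrreducible) (hn : 2 ≤ n) :
    ∃ U V : Matrix (Fin n) (Fin n) ℂ, U * (matX ρ - 1) + V * (matY ρ - 1) = 1 := by
  let M : Matrix (Fin n ⊕ Fin n) (Fin n) ℂ := fromRows (matX ρ - 1) (matY ρ - 1)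
  have hker : LinearMap.ker (Matrix.toLin' M) = ⊥ := by
    rw [LinearMap.ker_eq_bot']
    intro w hw
    rw [Matrix.toLin'_apply, fromRows_mulVec] at hw
    have h1 : (matX ρ - 1) *ᵥ w = 0 := by simpa using congrArg (fun v => v ∘ Sum.inl) hw
    have h2 : (matY ρ - 1) *ᵥ w = 0 := by simpa using congrArg (fun v => v ∘ Sum.inr) hw
    rw [sub_mulVec, one_mulVec, sub_eq_zero] at h1 h2
    exact eq_zero_of_common_eigenvector hρ hn (a := 1) (b := 1) (by rw [h1, one_smul])
      (by rw [h2, one_smul])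
  obtain ⟨g, hg⟩ := LinearMap.exists_leftInverse_of_injective _ hker
  have hN : LinearMap.toMatrix' g * M = 1 := by
    rw [← LinearMap.toMatrix'_toLin' M, ← LinearMap.toMatrix'_comp, hg, LinearMap.toMatrix'_id]
  refine ⟨(LinearMap.toMatrix' g).toCols₁, (LinearMap.toMatrix' g).toCols₂, ?_⟩
  rw [← fromCols_mul_fromRows, fromCols_toCols]
  exact hN

theorem matX_pow : matX ρ ^ p = (ρ (x p q ^ p) : Matrix (Fin n) (Fin n) ℂ) := by
  rw [map_pow]; exact (Matrix.SpecialLinearGroup.coe_pow _ _).symm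

theorem matX_pow_eq_matY_pow : matX ρ ^ p = matY ρ ^ q := by
  rw [matX_pow, x_pow_eq_y_pow, map_pow]; exact Matrix.SpecialLinearGroup.coe_pow _ _

theorem x_pow_central (g : TorusKnotGroup p q) : Commute (x p q ^ p) g := by
  have h : g ∈ Subgroup.centralizer {x p q ^ p} := PresentedGroup.generated_by _ _ (fun j => by
    rw [Subgroup.mem_centralizer_singleton_iff]
    fin_cases j
    · exact (Commute.self_pow (x p q) p).eq
    · change y p q * _ = _
      rw [x_pow_eq_y_pow]
      exact (Commute.self_pow (y p q) q).eq) g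
  exact (Subgroup.mem_centralizer_singleton_iff.1 h).symm

/-- Schur's lemma: `x^p = y^q` is central, so an eigenspace of its image is invariant and hence
everything. Determinant `1` gives `ω^n = 1`. -/
theorem exists_scalar (hρ : (linearRep ρ).IsIrreducible) :
    ∃ ω : ℂ, ω ^ n = 1 ∧ matX ρ ^ p = ω • 1 ∧ matY ρ ^ q = ω • 1 := by
  have hn := pos_of_isIrreducible hρ
  have : NeZero n := ⟨hn.ne'⟩
  obtain ⟨ω, hω⟩ := Module.End.exists_eigenvalue (linearRep ρ (x p q ^ p))
  have htop : Module.End.eigenspace (linearRep ρ (x p q ^ p)) ω = ⊤ := by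
    refine (hρ.submodule_eq_bot_or_eq_top _ fun g w hw => ?_).resolve_left hω
    rw [Module.End.mem_eigenspace_iff] at hw ⊢
    rw [← Module.End.mul_apply, ← map_mul, (x_pow_central g).eq, map_mul, Module.End.mul_apply, hw,
      map_smul]
  have hX : matX ρ ^ p = ω • 1 := by
    rw [matX_pow]
    apply Matrix.toLin'.injective
    ext1 i
    ext1
    have : LinearMap.single ℂ (fun _ => ℂ) i 1 ∈ Module.End.eigenspace (linearRep ρ (x p q ^ p)) ω := by
      rw [htop]; trivial
    rw [Module.End.mem_eigenspace_iff] at this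
    rw [LinearMap.comp_apply, LinearMap.comp_apply, map_smul, Matrix.toLin'_one, LinearMap.smul_apply,
      LinearMap.id_apply]
    exact this
  refine ⟨ω, ?_, hX, matX_pow_eq_matY_pow.symm.trans hX⟩
  have := congrArg Matrix.det hX
  rwa [matX_pow, Matrix.SpecialLinearGroup.det_coe, det_smul, det_one, mul_one, Fintype.card_fin,
    eq_comm] at this

/-- For `ω ≠ 0` the polynomial `X^k - ω` is squarefree, so `M` is semisimple and its geometric and
algebraic multiplicities agree. -/
theorem _root_.Matrix.finrank_eigenspace_eq_rootMultiplicity (M : Matrix (Fin n) (Fin n) ℂ) {k : ℕ}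
    (hk : 0 < k) {ω : ℂ} (hω : ω ≠ 0) (h : M ^ k = ω • 1) (a : ℂ) :
    Module.finrank ℂ (Module.End.eigenspace (Matrix.toLin' M) a) = M.charpoly.rootMultiplicity a := by
  have hss : Module.End.IsSemisimple (Matrix.toLin' M) := by
    refine Module.End.isSemisimple_of_squarefree_aeval_eq_zero
      (p := Polynomial.X ^ k - Polynomial.C ω) ?_ ?_
    · exact (Polynomial.separable_X_pow_sub_C ω (by exact_mod_cast hk.ne') hω).squarefree
    · rw [map_sub, map_pow, Polynomial.aeval_X, Polynomial.aeval_C, ← Matrix.toLin'_pow, h, map_smul,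
        Matrix.toLin'_one]
      exact sub_self _
  rw [← hss.isFinitelySemisimple.maxGenEigenspace_eq_eigenspace, LinearMap.finrank_maxGenEigenspace_eq,
    ← Matrix.charpoly_toLin']

/-- The two eigenspaces are disjoint, as a common vector would be a common eigenvector. This is the
inequality behind integrality. -/
theorem rootMultiplicity_add_le (hρ : (linearRep ρ).IsIrreducible) (hn : 2 ≤ n) (hp : 0 < p)
    (hq : 0 < q) (a b : ℂ) :
    (matX ρ).charpoly.rootMultiplicity a + (matY ρ).charpoly.rootMultiplicity b ≤ n := by
  obtain ⟨ω, hω, hX, hY⟩ := exists_scalar hρ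
  have hω0 : ω ≠ 0 := by
    rintro rfl
    rw [zero_pow (by omega)] at hω
    exact zero_ne_one hω
  rw [← finrank_eigenspace_eq_rootMultiplicity _ hp hω0 hX,
    ← finrank_eigenspace_eq_rootMultiplicity _ hq hω0 hY]
  refine (Submodule.finrank_add_finrank_le_of_disjoint ?_).trans (Module.finrank_fin_fun ℂ).le
  rw [Submodule.disjoint_def]
  intro w h1 h2
  rw [Module.End.mem_eigenspace_iff] at h1 h2
  exact eq_zero_of_common_eigenvector hρ hn h1 h2

end TorusKnotGroup

/-! ### Determinants and traces in terms of eigenvalues. -/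

namespace Matrix

open Polynomial

variable {n : ℕ} {M : Matrix (Fin n) (Fin n) ℂ} {α : Fin n → ℂ}

theorem exists_charpoly_eq_prod (M : Matrix (Fin n) (Fin n) ℂ) :
    ∃ α : Fin n → ℂ, M.charpoly = ∏ i, (X - C (α i)) := by
  have h1 := (IsAlgClosed.splits M.charpoly).eq_prod_roots_of_monic M.charpoly_monic
  have h2 : M.charpoly.roots.card = n := by
    rw [← (IsAlgClosed.splits M.charpoly).natDegree_eq_card_roots, M.charpoly_natDegree_eq_dim,
      Fintype.card_fin]
  have key : ∀ (m : ℕ) (s : Multiset ℂ), s.card = m → ∃ α : Fin m → ℂ,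
      (s.map fun a => X - C a).prod = ∏ i, (X - C (α i)) := by
    rintro m ⟨l⟩ rfl
    refine ⟨fun i => l.get i, ?_⟩
    change (l.map fun a => X - C a).prod = _
    exact (Fin.prod_univ_fun_getElem l _).symm
  obtain ⟨α, hα⟩ := key n _ h2
  exact ⟨α, h1.trans hα⟩

/-- Both sides are multiplicative in `f`, and `f` splits over `ℂ`. Constants are clear, and for `X -
a` the identity is the characteristic polynomial evaluated at `a`, up to sign. -/
theorem det_aeval (hM : M.charpoly = ∏ i, (X - C (α i))) (f : ℂ[X]) :
    (aeval M f).det = ∏ i, f.eval (α i) := by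
  let φ : ℂ[X] →* ℂ := detMonoidHom.comp (aeval M : ℂ[X] →ₐ[ℂ] Matrix (Fin n) (Fin n) ℂ).toMonoidHom
  let ψ : ℂ[X] →* ℂ :=
    { toFun := fun f => ∏ i, f.eval (α i)
      map_one' := by simp
      map_mul' := fun f g => by simp [Finset.prod_mul_distrib] }
  have hC : ∀ a, φ (C a) = ψ (C a) := fun a => by
    change (aeval M (C a)).det = ∏ i, (C a).eval (α i)
    rw [aeval_C, Algebra.algebraMap_eq_smul_one, det_smul]
    simp
  have hX : ∀ a, φ (X - C a) = ψ (X - C a) := fun a => by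
    change (aeval M (X - C a)).det = ∏ i, (X - C a).eval (α i)
    have h1 := congrArg (Polynomial.eval a) hM
    rw [eval_charpoly, eval_prod] at h1
    rw [map_sub, aeval_X, aeval_C, ← neg_sub, det_neg]
    change _ * (scalar (Fin n) a - M).det = _
    rw [h1, Fintype.card_fin, ← Fin.prod_const, ← Finset.prod_mul_distrib]
    exact Finset.prod_congr rfl fun i _ => by simp
  change φ f = ψ f
  rw [(IsAlgClosed.splits f).eq_prod_roots, map_mul, map_mul, hC, map_multiset_prod,
    map_multiset_prod, Multiset.map_map, Multiset.map_map]
  congr 2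
  exact Multiset.map_congr rfl fun a _ => hX a

theorem trace_pow_eq_sum (hM : M.charpoly = ∏ i, (X - C (α i))) (k : ℕ) :
    (M ^ k).trace = ∑ i, α i ^ k := by
  have h : (M ^ k).charpoly = ((Finset.univ.val.map fun i => α i ^ k).map fun a => X - C a).prod := by
    refine Polynomial.funext fun z => ?_
    have h1 := det_aeval hM (C z - X ^ k)
    rw [map_sub, aeval_C, map_pow, aeval_X] at h1
    rw [eval_charpoly, Multiset.map_map]
    refine h1.trans ?_
    change _ = eval z (∏ i, (X - C (α i ^ k)))
    rw [eval_prod]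
    simp
  rw [trace_eq_sum_roots_charpoly, h, roots_multiset_prod_X_sub_C]
  rfl

theorem det_smul_sub_one (hM : M.charpoly = ∏ i, (X - C (α i))) (s : ℂ) :
    (s • M - 1).det = ∏ i, (s * α i - 1) := by
  have h1 := det_aeval hM (C s * X - 1)
  rw [map_sub, map_mul, aeval_C, aeval_X, map_one, ← Algebra.smul_def] at h1
  simpa using h1

/-- An eigenvector `w` for `α i` is an eigenvector of `M^k` for `α i ^ k`, because `X - α i` divides
`X^k - α i ^ k`. -/
theorem pow_eq_of_charpoly (hM : M.charpoly = ∏ i, (X - C (α i))) {k : ℕ} {ω : ℂ}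
    (h : M ^ k = ω • 1) (i : Fin n) : α i ^ k = ω := by
  have h2 := det_aeval hM (X - C (α i))
  have h3 : ∃ w : Fin n → ℂ, w ≠ 0 ∧ aeval M (X - C (α i)) *ᵥ w = 0 := by
    rw [exists_mulVec_eq_zero_iff, h2]
    exact Finset.prod_eq_zero (Finset.mem_univ i) (by simp)
  obtain ⟨w, hw, hw0⟩ := h3
  have hdvd : X - C (α i) ∣ X ^ k - C (α i ^ k) := by
    rw [C_pow]; exact sub_dvd_pow_sub_pow _ _ _
  obtain ⟨g, hg⟩ := hdvd
  have h4 : (M ^ k - (α i ^ k) • 1) *ᵥ w = 0 := by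
    have := congrArg (aeval M) hg
    rw [mul_comm, map_mul, map_sub, map_pow, aeval_X, aeval_C, Algebra.algebraMap_eq_smul_one] at this
    rw [this, ← mulVec_mulVec, hw0, mulVec_zero]
  rw [h, ← sub_smul, smul_mulVec, one_mulVec, smul_eq_zero, sub_eq_zero] at h4
  exact (h4.resolve_right hw).symm

end Matrix

open Polynomial in
-- Dedekind independence: distinct `c` give distinct monoid homomorphisms `k ↦ c^k`, so equal power
-- sums force each `c` to have equal multiplicity in both families.
theorem prod_X_sub_C_eq_of_power_sums {n : ℕ} (α β : Fin n → ℂ)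
    (h : ∀ k : ℕ, ∑ i, α i ^ k = ∑ i, β i ^ k) :
    ∏ i, (X - C (α i)) = ∏ i, (X - C (β i)) := by
  classical
  let e : ℂ → (Multiplicative ℕ →* ℂ) := fun c => powersHom ℂ c
  have hinj : Function.Injective e := (powersHom ℂ).injective
  have hli := linearIndependent_monoidHom (Multiplicative ℕ) ℂ
  have hfs : ∑ i, Finsupp.single (e (α i)) (1 : ℂ) = ∑ i, Finsupp.single (e (β i)) (1 : ℂ) := by
    apply hli
    rw [map_sum, map_sum]
    simp only [Finsupp.linearCombination_single, one_smul]
    ext k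
    rw [Finset.sum_apply, Finset.sum_apply]
    simpa [e, powersHom_apply] using h k.toAdd
  have hm : Finset.univ.val.map α = Finset.univ.val.map β := by
    ext c
    -- The coefficient at `e c` counts the indices with value `c`, as a complex number;
    -- characteristic zero recovers the count.
    have h1 := DFunLike.congr_fun hfs (e c)
    rw [Finsupp.finsetSum_apply, Finsupp.finsetSum_apply] at h1
    simp only [Finsupp.single_apply, hinj.eq_iff, Finset.sum_boole, Nat.cast_inj] at h1
    rw [Multiset.count_map, Multiset.count_map]
    simp only [eq_comm (a := c)]
    exact h1
  have h2 := congrArg (fun s => (Multiset.map (fun a => X - C a) s).prod) hm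
  rw [Multiset.map_map, Multiset.map_map] at h2
  exact h2

/-! ### The limit formula. -/

/-- The rational function of the eigenvalues whose limit at `1` is the torsion. -/
def torsionQuotient (p q : ℕ) {n : ℕ} (ω : ℂ) (α β : Fin n → ℂ) (t : ℂ) : ℂ :=
  (t ^ (p * q) * ω - 1) ^ n / ((∏ i, (t ^ q * α i - 1)) * ∏ j, (t ^ p * β j - 1))

theorem eventually_pow_mul_ne_one {k : ℕ} (hk : 0 < k) (ω : ℂ) :
    ∀ᶠ t : ℂ in 𝓝[≠] 1, t ^ k * ω - 1 ≠ 0 := by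
  have hfin : {t : ℂ | t ^ k * ω - 1 = 0}.Finite := by
    refine Set.Finite.subset (Polynomial.nthRoots k ω⁻¹).toFinset.finite_toSet fun t ht => ?_
    have ht' : t ^ k * ω = 1 := sub_eq_zero.1 ht
    simpa [Polynomial.mem_nthRoots hk] using eq_inv_of_mul_eq_one_left ht'
  exact nhdsNE_le_cofinite 1 hfin.compl_mem_cofinite

theorem tendsto_torsionQuotient {p q n : ℕ} (hp : 0 < p) (hq : 0 < q)
    {X Y U V : Matrix (Fin n) (Fin n) ℂ}
    {ω : ℂ} (hX : X ^ p = ω • 1) (hY : Y ^ q = ω • 1) (hUV : U * (X - 1) + V * (Y - 1) = 1)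
    {α β : Fin n → ℂ} (hα : X.charpoly = ∏ i, (Polynomial.X - Polynomial.C (α i)))
    (hβ : Y.charpoly = ∏ j, (Polynomial.X - Polynomial.C (β j))) :
    Tendsto (torsionQuotient p q ω α β) (𝓝[≠] 1)
      (𝓝 (fromBlocks (∑ i ∈ Finset.range p, X ^ i) (-∑ i ∈ Finset.range q, Y ^ i) U V).det) := by
  let A : ℂ → Matrix (Fin n) (Fin n) ℂ := fun t => ∑ i ∈ Finset.range p, (t ^ q • X) ^ i
  let B : ℂ → Matrix (Fin n) (Fin n) ℂ := fun t => ∑ i ∈ Finset.range q, (t ^ p • Y) ^ i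
  let F : ℂ → Matrix (Fin n ⊕ Fin n) (Fin n ⊕ Fin n) ℂ := fun t => fromBlocks (A t) (-B t) U V
  let W : ℂ → Matrix (Fin n) (Fin n) ℂ := fun t => U * (t ^ q • X - 1) + V * (t ^ p • Y - 1)
  have hA : ∀ t, A t * (t ^ q • X - 1) = (t ^ (p * q) * ω - 1) • 1 := fun t => by
    rw [geom_sum_mul, smul_pow, hX, smul_smul, ← pow_mul, mul_comm q p, sub_smul, one_smul]
  have hB : ∀ t, B t * (t ^ p • Y - 1) = (t ^ (p * q) * ω - 1) • 1 := fun t => by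
    rw [geom_sum_mul, smul_pow, hY, smul_smul, ← pow_mul, sub_smul, one_smul]
  have hdetA : ∀ t, (A t).det * (t ^ q • X - 1).det = (t ^ (p * q) * ω - 1) ^ n := fun t => by
    rw [← det_mul, hA, det_smul, det_one, mul_one, Fintype.card_fin]
  have hdetB : ∀ t, (B t).det * (t ^ p • Y - 1).det = (t ^ (p * q) * ω - 1) ^ n := fun t => by
    rw [← det_mul, hB, det_smul, det_one, mul_one, Fintype.card_fin]
  have hF : ∀ t, (F t).det * (t ^ p • Y - 1).det = (A t).det * (W t).det := fun t => by
    -- The upper right corner cancels because both geometric sums telescope to the same scalar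
    -- `t^(pq) ω - 1`: this is where the exponents `q` and `p` of the deformation are matched.
    have h1 : F t * fromBlocks 1 (t ^ q • X - 1) 0 (t ^ p • Y - 1) = fromBlocks (A t) 0 U (W t) := by
      rw [fromBlocks_multiply]
      simp only [Matrix.mul_one, Matrix.mul_zero, add_zero, Matrix.neg_mul, hA, hB, add_neg_cancel]
      rfl
    have h2 := congrArg Matrix.det h1
    rwa [det_mul, det_fromBlocks_zero₂₁, det_fromBlocks_zero₁₂, det_one, one_mul] at h2
  have hcF : Continuous fun t => (F t).det := by
    refine Continuous.matrix_det (Continuous.matrix_fromBlocks ?_ ?_ ?_ ?_)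
    · exact continuous_finsetSum _ fun i _ => ((continuous_pow q).smul continuous_const).pow i
    · exact (continuous_finsetSum _ fun i _ => ((continuous_pow p).smul continuous_const).pow i).neg
    · exact continuous_const
    · exact continuous_const
  have hcW : Continuous fun t => (W t).det := by
    refine Continuous.matrix_det (Continuous.add ?_ ?_)
    · exact continuous_const.matrix_mul (((continuous_pow q).smul continuous_const).sub continuous_const)
    · exact continuous_const.matrix_mul (((continuous_pow p).smul continuous_const).sub continuous_const)
  have hW1 : (W 1).det = 1 := by
    simp only [W, one_pow, one_smul, hUV, det_one]
  have hF1 : (F 1).det =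
      (fromBlocks (∑ i ∈ Finset.range p, X ^ i) (-∑ i ∈ Finset.range q, Y ^ i) U V).det := by
    simp only [F, A, B, one_pow, one_smul]
  have hlim : Tendsto (fun t => (F t).det / (W t).det) (𝓝[≠] 1) (𝓝 ((F 1).det / (W 1).det)) :=
    ((hcF.tendsto 1).div (hcW.tendsto 1) (by rw [hW1]; exact one_ne_zero)).mono_left nhdsWithin_le_nhds
  rw [hW1, div_one, hF1] at hlim
  refine hlim.congr' ?_
  have hWne : ∀ᶠ t in 𝓝[≠] (1 : ℂ), (W t).det ≠ 0 :=
    ((hcW.tendsto 1).eventually_ne (by rw [hW1]; exact one_ne_zero)).filter_mono nhdsWithin_le_nhds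
  -- By `hdetA` and `hdetB`, avoiding the zeros of the numerator also avoids those of the
  -- denominator.
  filter_upwards [hWne, eventually_pow_mul_ne_one (mul_pos hp hq) ω] with t h1 h2
  have h2' := pow_ne_zero n h2
  have hX0 : (t ^ q • X - 1).det ≠ 0 := fun h0 => h2' (by rw [← hdetA, h0, mul_zero])
  have hY0 : (t ^ p • Y - 1).det ≠ 0 := fun h0 => h2' (by rw [← hdetB, h0, mul_zero])
  rw [torsionQuotient, ← det_smul_sub_one hα, ← det_smul_sub_one hβ, ← hdetA, div_eq_div_iff h1
    (mul_ne_zero hX0 hY0)]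
  linear_combination (t ^ q • X - 1).det * hF t

/-! ### Integrality. -/

/-- The cofactor of `∏ (s α_i - 1)` in a power of `s ^ p ω - 1`. -/
def torsionCofactor (p : ℕ) {n : ℕ} (ω : ℂ) (α : Fin n → ℂ) (m : ℕ) (s : ℂ) : ℂ :=
  ((-1) ^ (p + 1)) ^ m * ∏ a ∈ (Polynomial.nthRoots p ω).toFinset,
    (s * a - 1) ^ (m - (Finset.univ.filter fun i => α i = a).card)

/-- For `s ≠ 0`, evaluate `X^p - ω = ∏ (X - a)` at `s⁻¹` and multiply by `(-s)^p`; the roots are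
simple, so a product over a finset suffices. -/
theorem prod_nthRoots_mul_sub_one {p : ℕ} (hp : 0 < p) {ω : ℂ} (hω : ω ≠ 0) (s : ℂ) :
    ∏ a ∈ (Polynomial.nthRoots p ω).toFinset, (s * a - 1) = (-1) ^ (p + 1) * (s ^ p * ω - 1) := by
  have hsep := Polynomial.separable_X_pow_sub_C (F := ℂ) ω (n := p) (by exact_mod_cast hp.ne') hω
  have hnodup : (Polynomial.nthRoots p ω).Nodup := Polynomial.nodup_roots hsep
  have hspl := IsAlgClosed.splits (Polynomial.X ^ p - Polynomial.C ω : Polynomial ℂ)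
  have hfac := hspl.eq_prod_roots_of_monic (Polynomial.monic_X_pow_sub_C ω hp.ne')
  have hcard : (Polynomial.nthRoots p ω).toFinset.card = p := by
    rw [Multiset.toFinset_card_of_nodup hnodup, Polynomial.nthRoots, ← hspl.natDegree_eq_card_roots,
      Polynomial.natDegree_X_pow_sub_C]
  have hprod : (Polynomial.X ^ p - Polynomial.C ω : Polynomial ℂ) =
      ∏ a ∈ (Polynomial.nthRoots p ω).toFinset, (Polynomial.X - Polynomial.C a) := by
    change _ = ((Polynomial.nthRoots p ω).toFinset.val.map fun a =>
      Polynomial.X - Polynomial.C a).prod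
    rw [Multiset.toFinset_val, hnodup.dedup]
    exact hfac
  by_cases hs : s = 0
  · subst hs
    simp [hcard, hp.ne', pow_succ]
  · have h1 := congrArg (Polynomial.eval s⁻¹) hprod
    rw [Polynomial.eval_prod] at h1
    simp only [Polynomial.eval_sub, Polynomial.eval_pow, Polynomial.eval_X, Polynomial.eval_C] at h1
    have h2 : ∀ a, s * a - 1 = -s * (s⁻¹ - a) := fun a => by field_simp; ring
    simp only [h2, Finset.prod_mul_distrib, Finset.prod_const, hcard]
    have h3 : s ^ p * s⁻¹ ^ p = 1 := by rw [← mul_pow, mul_inv_cancel₀ hs, one_pow]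
    rw [← h1, neg_pow s, pow_succ]
    linear_combination (-1) ^ p * h3

/-- Every `α i` is one of the `p` roots, and each root occurs at most `m` times, so the cofactor
supplies the missing powers without truncated subtraction. -/
theorem pow_eq_torsionCofactor_mul {p n : ℕ} (hp : 0 < p) {ω : ℂ} (hω : ω ≠ 0) {α : Fin n → ℂ}
    (hα : ∀ i, α i ^ p = ω) {m : ℕ} (hm : ∀ a, (Finset.univ.filter fun i => α i = a).card ≤ m)
    (s : ℂ) :
    (s ^ p * ω - 1) ^ m = torsionCofactor p ω α m s * ∏ i, (s * α i - 1) := by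
  have h1 : ∏ i, (s * α i - 1) = ∏ a ∈ (Polynomial.nthRoots p ω).toFinset,
      (s * a - 1) ^ (Finset.univ.filter fun i => α i = a).card := by
    rw [← Finset.prod_fiberwise_of_maps_to (s := Finset.univ) (g := α)
      (t := (Polynomial.nthRoots p ω).toFinset) (fun i _ => by
        simpa [Polynomial.mem_nthRoots hp] using hα i)]
    refine Finset.prod_congr rfl fun a _ => ?_
    rw [← Finset.prod_const]
    exact Finset.prod_congr rfl fun i hi => by rw [(Finset.mem_filter.1 hi).2]
  rw [torsionCofactor, h1, mul_assoc, ← Finset.prod_mul_distrib]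
  simp only [← pow_add, Nat.sub_add_cancel (hm _)]
  rw [Finset.prod_pow, prod_nthRoots_mul_sub_one hp hω, ← mul_pow, ← mul_assoc, ← mul_pow]
  simp

theorem isIntegral_torsionCofactor {p n : ℕ} (hp : 0 < p) {ω : ℂ} (hω : IsIntegral ℤ ω)
    (α : Fin n → ℂ) (m : ℕ) : IsIntegral ℤ (torsionCofactor p ω α m 1) := by
  refine IsIntegral.mul (((isIntegral_one.neg).pow _).pow _) (IsIntegral.prod _ fun a ha => ?_)
  have ha' : a ^ p = ω := by simpa [Polynomial.mem_nthRoots hp] using ha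
  rw [one_mul]
  exact ((IsIntegral.of_pow hp (ha' ▸ hω)).sub isIntegral_one).pow _

theorem isIntegral_of_tendsto_torsionQuotient {p q n : ℕ} (hp : 0 < p) (hq : 0 < q) (hn : 0 < n)
    {ω : ℂ} (hω : ω ^ n = 1) {α β : Fin n → ℂ} (hα : ∀ i, α i ^ p = ω) (hβ : ∀ i, β i ^ q = ω)
    (hαβ : ∀ a b, (Finset.univ.filter fun i => α i = a).card +
      (Finset.univ.filter fun i => β i = b).card ≤ n)
    {T : ℂ} (hT : Tendsto (torsionQuotient p q ω α β) (𝓝[≠] 1) (𝓝 T)) : IsIntegral ℤ T := by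
  have hω0 : ω ≠ 0 := by
    rintro rfl
    rw [zero_pow hn.ne'] at hω
    exact zero_ne_one hω
  have hωint : IsIntegral ℤ ω := IsIntegral.of_pow hn (by rw [hω]; exact isIntegral_one)
  -- Take `m` to be the largest multiplicity among the `α i` and `k = n - m`; by `hαβ` this bounds
  -- the multiplicities of the `β i`.
  obtain ⟨m, k, hmk, hm, hk⟩ : ∃ m k, m + k = n ∧
      (∀ a, (Finset.univ.filter fun i => α i = a).card ≤ m) ∧
      ∀ b, (Finset.univ.filter fun i => β i = b).card ≤ k := by
    have hfin : (Set.range fun a => (Finset.univ.filter fun i => α i = a).card).Finite :=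
      (Set.finite_Iic n).subset (by rintro _ ⟨a, rfl⟩; exact le_of_add_le_left (hαβ a 0))
    obtain ⟨_, ⟨a, rfl⟩, ha⟩ := hfin.exists_maximal (Set.range_nonempty _)
    have hmax : ∀ b, (Finset.univ.filter fun i => α i = b).card ≤
        (Finset.univ.filter fun i => α i = a).card := fun b => by
      rcases le_total (Finset.univ.filter fun i => α i = b).card
        (Finset.univ.filter fun i => α i = a).card with h | h
      · exact h
      · exact ha ⟨b, rfl⟩ h
    refine ⟨_, n - (Finset.univ.filter fun i => α i = a).card, ?_, hmax, fun b => ?_⟩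
    · have := hαβ a 0
      omega
    · have := hαβ a b
      omega
  have hcont : Continuous fun t : ℂ => torsionCofactor p ω α m (t ^ q) * torsionCofactor q ω β k (t ^ p) := by
    unfold torsionCofactor
    fun_prop
  have hlim := (hcont.tendsto 1).mono_left (nhdsWithin_le_nhds (s := {1}ᶜ))
  rw [one_pow, one_pow] at hlim
  -- Near `1` the quotient equals the product of the two cofactors, which is continuous, so `T` is
  -- its value at `1`.
  have hTeq := tendsto_nhds_unique (hlim.congr' ?_) hT
  · rw [← hTeq]
    exact (isIntegral_torsionCofactor hp hωint α m).mul (isIntegral_torsionCofactor hq hωint β k)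
  · filter_upwards [eventually_pow_mul_ne_one (mul_pos hp hq) ω] with t ht
    have h1 := pow_eq_torsionCofactor_mul hp hω0 hα hm (t ^ q)
    have h2 := pow_eq_torsionCofactor_mul hq hω0 hβ hk (t ^ p)
    rw [← pow_mul, mul_comm q p] at h1
    rw [← pow_mul] at h2
    have h3 : (∏ i, (t ^ q * α i - 1)) * ∏ j, (t ^ p * β j - 1) ≠ 0 := by
      refine mul_ne_zero ?_ ?_
      · exact right_ne_zero_of_mul (h1 ▸ pow_ne_zero m ht)
      · exact right_ne_zero_of_mul (h2 ▸ pow_ne_zero k ht)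
    rw [torsionQuotient, eq_div_iff h3]
    calc _ = (torsionCofactor p ω α m (t ^ q) * ∏ i, (t ^ q * α i - 1)) *
          (torsionCofactor q ω β k (t ^ p) * ∏ j, (t ^ p * β j - 1)) := by ring
      _ = _ := by rw [← h1, ← h2, ← pow_add, hmk]

theorem torsionQuotient_tendsto_of_ne_one {p q n : ℕ} {ω : ℂ} {α β : Fin n → ℂ}
    (hα : ∀ i, α i ≠ 1) (hβ : ∀ i, β i ≠ 1) :
    Tendsto (torsionQuotient p q ω α β) (𝓝[≠] 1)
      (𝓝 ((ω - 1) ^ n / ((∏ i, (α i - 1)) * ∏ j, (β j - 1)))) := by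
  have h : ContinuousAt (torsionQuotient p q ω α β) 1 := by
    unfold torsionQuotient
    refine ContinuousAt.div (by fun_prop) (by fun_prop) ?_
    simp only [one_pow, one_mul]
    exact mul_ne_zero (Finset.prod_ne_zero_iff.2 fun i _ => sub_ne_zero.2 (hα i))
      (Finset.prod_ne_zero_iff.2 fun i _ => sub_ne_zero.2 (hβ i))
  have h1 := h.tendsto.mono_left (nhdsWithin_le_nhds (s := {1}ᶜ))
  simpa [torsionQuotient] using h1


/-! ### Dependence on the character and local constancy. -/

namespace TorusKnotGroup

variable {p q n : ℕ} {ρ ρ' : TorusKnotGroup p q →* Matrix.SpecialLinearGroup (Fin n) ℂ}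

theorem specialCharacter_x_pow (k : ℕ) :
    specialCharacter ρ (x p q ^ k) = (matX ρ ^ k).trace := by
  rw [specialCharacter, map_pow]
  exact congrArg Matrix.trace (Matrix.SpecialLinearGroup.coe_pow _ _)

theorem specialCharacter_y_pow (k : ℕ) :
    specialCharacter ρ (y p q ^ k) = (matY ρ ^ k).trace := by
  rw [specialCharacter, map_pow]
  exact congrArg Matrix.trace (Matrix.SpecialLinearGroup.coe_pow _ _)

/-- The values of a character on the powers of the generators. -/
def powerTraces (χ : TorusKnotGroup p q → ℂ) : (ℕ → ℂ) × (ℕ → ℂ) :=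
  (fun k => χ (x p q ^ k), fun k => χ (y p q ^ k))

theorem continuous_powerTraces : Continuous (powerTraces (p := p) (q := q)) :=
  (continuous_pi fun _ => continuous_apply _).prodMk (continuous_pi fun _ => continuous_apply _)

/-- Both determinants are limits of one and the same quotient: `tr X^p = n ω` determines `ω`, and
the power traces determine the eigenvalues. No conjugacy of `ρ` and `ρ'` is needed, and the sign is
preserved. -/
theorem det_torsionMatrix_eq (hp : 0 < p) (hq : 0 < q) (hρ : (linearRep ρ).IsIrreducible)
    (hρ' : (linearRep ρ').IsIrreducible)
    (h : powerTraces (specialCharacter ρ) = powerTraces (specialCharacter ρ'))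
    {U V U' V' : Matrix (Fin n) (Fin n) ℂ} (hUV : U * (matX ρ - 1) + V * (matY ρ - 1) = 1)
    (hUV' : U' * (matX ρ' - 1) + V' * (matY ρ' - 1) = 1) :
    (torsionMatrix ρ U V).det = (torsionMatrix ρ' U' V').det := by
  have hn := pos_of_isIrreducible hρ
  obtain ⟨ω, -, hX, hY⟩ := exists_scalar hρ
  obtain ⟨ω', -, hX', hY'⟩ := exists_scalar hρ'
  have hx : ∀ k, (matX ρ ^ k).trace = (matX ρ' ^ k).trace := fun k => by
    rw [← specialCharacter_x_pow, ← specialCharacter_x_pow]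
    exact congrFun (congrArg Prod.fst h) k
  have hy : ∀ k, (matY ρ ^ k).trace = (matY ρ' ^ k).trace := fun k => by
    rw [← specialCharacter_y_pow, ← specialCharacter_y_pow]
    exact congrFun (congrArg Prod.snd h) k
  have hω : ω = ω' := by
    have h1 := hx p
    rw [hX, hX', trace_smul, trace_smul, trace_one, Fintype.card_fin] at h1
    exact mul_right_cancel₀ (Nat.cast_ne_zero.2 hn.ne') h1
  subst hω
  obtain ⟨α, hα⟩ := exists_charpoly_eq_prod (matX ρ)
  obtain ⟨β, hβ⟩ := exists_charpoly_eq_prod (matY ρ)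
  obtain ⟨α', hα'⟩ := exists_charpoly_eq_prod (matX ρ')
  obtain ⟨β', hβ'⟩ := exists_charpoly_eq_prod (matY ρ')
  have hαα' := prod_X_sub_C_eq_of_power_sums α α' fun k => by
    rw [← trace_pow_eq_sum hα, ← trace_pow_eq_sum hα', hx]
  have hββ' := prod_X_sub_C_eq_of_power_sums β β' fun k => by
    rw [← trace_pow_eq_sum hβ, ← trace_pow_eq_sum hβ', hy]
  exact tendsto_nhds_unique (tendsto_torsionQuotient hp hq hX hY hUV hα hβ)
    (tendsto_torsionQuotient hp hq hX' hY' hUV' (hα'.trans hαα'.symm) (hβ'.trans hββ'.symm))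

/-- From `X^p = Y^q = ω` and `ω^n = 1`, the eigenvalues are roots of unity of orders dividing `p n`
and `q n`, so only finitely many tuples occur. -/
theorem finite_powerTraces (hp : 0 < p) (hq : 0 < q) :
    (powerTraces '' irreducibleCharacters (TorusKnotGroup p q) n).Finite := by
  have hfin : ∀ m : ℕ, 0 < m →
      ((fun (α : Fin n → ℂ) (k : ℕ) => ∑ i, α i ^ k) ''
        Set.pi Set.univ fun _ => {z : ℂ | z ^ m = 1}).Finite := fun m hm => by
    refine Set.Finite.image _ (Set.Finite.pi fun _ => ?_)
    refine Set.Finite.subset (Polynomial.nthRoots m (1 : ℂ)).toFinset.finite_toSet fun z hz => ?_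
    simpa [Polynomial.mem_nthRoots hm] using hz
  rcases Nat.eq_zero_or_pos n with rfl | hn
  · refine Set.Finite.subset Set.finite_empty ?_
    rintro _ ⟨_, ⟨ρ, hρ, -⟩, -⟩
    exact absurd (pos_of_isIrreducible hρ) (lt_irrefl 0)
  refine Set.Finite.subset ((hfin (p * n) (mul_pos hp hn)).prod (hfin (q * n) (mul_pos hq hn))) ?_
  rintro _ ⟨_, ⟨ρ, hρ, rfl⟩, rfl⟩
  obtain ⟨ω, hω, hX, hY⟩ := exists_scalar hρ
  obtain ⟨α, hα⟩ := exists_charpoly_eq_prod (matX ρ)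
  obtain ⟨β, hβ⟩ := exists_charpoly_eq_prod (matY ρ)
  refine ⟨⟨α, fun i _ => ?_, funext fun k => ?_⟩, ⟨β, fun i _ => ?_, funext fun k => ?_⟩⟩
  · change α i ^ (p * n) = 1
    rw [pow_mul, pow_eq_of_charpoly hα hX, hω]
  · exact (trace_pow_eq_sum hα k).symm.trans (specialCharacter_x_pow k).symm
  · change β i ^ (q * n) = 1
    rw [pow_mul, pow_eq_of_charpoly hβ hY, hω]
  · exact (trace_pow_eq_sum hβ k).symm.trans (specialCharacter_y_pow k).symm

/-- A continuous map into a finite Hausdorff space, which is discrete, is locally constant. -/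
theorem isLocallyConstant_powerTraces (hp : 0 < p) (hq : 0 < q) :
    IsLocallyConstant fun χ : irreducibleCharacters (TorusKnotGroup p q) n => powerTraces χ.1 := by
  have hfin := (finite_powerTraces (n := n) hp hq).to_subtype
  have hc : Continuous fun χ : irreducibleCharacters (TorusKnotGroup p q) n =>
      (⟨powerTraces χ.1, χ.1, χ.2, rfl⟩ :
        powerTraces '' irreducibleCharacters (TorusKnotGroup p q) n) :=
    (continuous_powerTraces.comp continuous_subtype_val).subtype_mk _
  exact ((IsLocallyConstant.iff_continuous _).2 hc).comp Subtype.val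

theorem card_filter_add_le (hρ : (linearRep ρ).IsIrreducible) (hn : 2 ≤ n) (hp : 0 < p) (hq : 0 < q)
    {α β : Fin n → ℂ} (hα : (matX ρ).charpoly = ∏ i, (Polynomial.X - Polynomial.C (α i)))
    (hβ : (matY ρ).charpoly = ∏ j, (Polynomial.X - Polynomial.C (β j))) (a b : ℂ) :
    (Finset.univ.filter fun i => α i = a).card + (Finset.univ.filter fun i => β i = b).card ≤ n := by
  have key : ∀ (γ : Fin n → ℂ) (c : ℂ), (Finset.univ.filter fun i => γ i = c).card =
      (∏ i, (Polynomial.X - Polynomial.C (γ i))).rootMultiplicity c := fun γ c => by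
    have h1 : ∏ i, (Polynomial.X - Polynomial.C (γ i)) =
        ((Finset.univ.val.map γ).map fun a => Polynomial.X - Polynomial.C a).prod := by
      rw [Multiset.map_map]; rfl
    rw [← Polynomial.count_roots, h1, Polynomial.roots_multiset_prod_X_sub_C, Multiset.count_map]
    simp only [eq_comm (a := c)]
    rfl
  rw [key, key, ← hα, ← hβ]
  exact rootMultiplicity_add_le hρ hn hp hq a b

theorem coe_eq_one_of_dim_one (ρ : TorusKnotGroup p q →* Matrix.SpecialLinearGroup (Fin 1) ℂ)
    (g : TorusKnotGroup p q) : (ρ g : Matrix (Fin 1) (Fin 1) ℂ) = 1 := by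
  have h := (ρ g).2
  rw [det_fin_one] at h
  ext i j
  rw [Subsingleton.elim i 0, Subsingleton.elim j 0]
  exact h

end TorusKnotGroup

end

/-! ### The theorem. -/

theorem corollary1p2 (p q n : ℕ) (hp : 0 < p) (hq : 0 < q) (hpq : p.Coprime q) :
    ∃ τ : irreducibleCharacters (TorusKnotGroup p q) n → ℂ,
      IsLocallyConstant τ ∧
      ∀ (ρ : TorusKnotGroup p q →* Matrix.SpecialLinearGroup (Fin n) ℂ)
        (hρ : (linearRep ρ).IsIrreducible),
        let T : ℂ := τ ⟨specialCharacter ρ, ρ, hρ, rfl⟩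
        let X : Matrix (Fin n) (Fin n) ℂ := ρ (TorusKnotGroup.x p q)
        let Y : Matrix (Fin n) (Fin n) ℂ := ρ (TorusKnotGroup.y p q)
        (∀ z : ℂ, IsReidemeisterTorsion p q ρ z ↔ z = T ∨ z = -T) ∧
        IsIntegral ℤ T ∧
        (2 ≤ n →
          ∃ ω : ℂ, ω ^ n = 1 ∧ X ^ p = ω • 1 ∧ Y ^ q = ω • 1 ∧
            ∀ α β : Fin n → ℂ,
              X.charpoly = ∏ i, (Polynomial.X - Polynomial.C (α i)) →
              Y.charpoly = ∏ j, (Polynomial.X - Polynomial.C (β j)) →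
              Tendsto
                (fun t : ℂ => (t ^ (p * q) * ω - 1) ^ n /
                  ((∏ i, (t ^ q * α i - 1)) * ∏ j, (t ^ p * β j - 1)))
                (𝓝[≠] 1) (𝓝 T) ∧
              ((∀ i, α i ≠ 1) → (∀ j, β j ≠ 1) →
                T = (ω - 1) ^ n / ((∏ i, (α i - 1)) * ∏ j, (β j - 1)))) := by
  rcases Nat.lt_or_ge n 2 with hn | hn
  -- Irreducibility excludes `n = 0`, and `SL_1` is trivial, so here only the trivial representation
  -- remains, with torsion `0`.
  · refine ⟨fun _ => 0, IsLocallyConstant.const 0, fun ρ hρ => ?_⟩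
    have hn0 := TorusKnotGroup.pos_of_isIrreducible hρ
    obtain rfl : n = 1 := by omega
    refine ⟨fun z => ?_, isIntegral_zero, fun h => absurd h (by norm_num)⟩
    rw [neg_zero, or_self]
    exact TorusKnotGroup.isReidemeisterTorsion_trivial ρ (TorusKnotGroup.coe_eq_one_of_dim_one ρ _) (TorusKnotGroup.coe_eq_one_of_dim_one ρ _) z
  · have hex : ∀ χ : irreducibleCharacters (TorusKnotGroup p q) n,
        ∃ (ρ : TorusKnotGroup p q →* Matrix.SpecialLinearGroup (Fin n) ℂ)
          (U V : Matrix (Fin n) (Fin n) ℂ), (linearRep ρ).IsIrreducible ∧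
          specialCharacter ρ = χ.1 ∧ U * (TorusKnotGroup.matX ρ - 1) + V * (TorusKnotGroup.matY ρ - 1) = 1 := by
      rintro ⟨χ, ρ, hρ, hχ⟩
      obtain ⟨U, V, hUV⟩ := TorusKnotGroup.exists_right_inverse hρ hn
      exact ⟨ρ, U, V, hρ, hχ, hUV⟩
    choose ρ₀ U₀ V₀ hρ₀ hχ₀ hUV₀ using hex
    -- The determinant fixes the signs. The arbitrary choices of `ρ₀`, `U₀`, `V₀` are harmless,
    -- since its value depends only on power traces.
    refine ⟨fun χ => (TorusKnotGroup.torsionMatrix (ρ₀ χ) (U₀ χ) (V₀ χ)).det, ?_, fun ρ hρ => ?_⟩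
    · rw [IsLocallyConstant.iff_eventually_eq]
      intro χ
      filter_upwards [((IsLocallyConstant.iff_eventually_eq _).1
        (TorusKnotGroup.isLocallyConstant_powerTraces hp hq)) χ] with χ' h
      refine TorusKnotGroup.det_torsionMatrix_eq hp hq (hρ₀ χ') (hρ₀ χ) ?_ (hUV₀ χ') (hUV₀ χ)
      rw [hχ₀, hχ₀]
      exact h
    · intro T X Y
      obtain ⟨U, V, hUV⟩ := TorusKnotGroup.exists_right_inverse hρ hn
      have hT : T = (TorusKnotGroup.torsionMatrix ρ U V).det :=
        TorusKnotGroup.det_torsionMatrix_eq hp hq (hρ₀ _) hρ (by rw [hχ₀]) (hUV₀ _) hUV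
      obtain ⟨ω, hω, hX, hY⟩ := TorusKnotGroup.exists_scalar hρ
      have hlim : ∀ α β : Fin n → ℂ,
          (TorusKnotGroup.matX ρ).charpoly = ∏ i, (Polynomial.X - Polynomial.C (α i)) →
          (TorusKnotGroup.matY ρ).charpoly = ∏ j, (Polynomial.X - Polynomial.C (β j)) →
          Tendsto (torsionQuotient p q ω α β) (𝓝[≠] 1) (𝓝 T) := fun α β hα hβ => by
        rw [hT]
        exact tendsto_torsionQuotient hp hq hX hY hUV hα hβ
      refine ⟨fun z => ?_, ?_, fun _ => ⟨ω, hω, hX, hY, fun α β hα hβ => ⟨hlim α β hα hβ, ?_⟩⟩⟩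
      · rw [TorusKnotGroup.isReidemeisterTorsion_iff ρ U V hUV, ← hT, sq_eq_sq_iff_eq_or_eq_neg]
      · obtain ⟨α, hα⟩ := Matrix.exists_charpoly_eq_prod (TorusKnotGroup.matX ρ)
        obtain ⟨β, hβ⟩ := Matrix.exists_charpoly_eq_prod (TorusKnotGroup.matY ρ)
        exact isIntegral_of_tendsto_torsionQuotient hp hq (by omega) hω
          (Matrix.pow_eq_of_charpoly hα hX) (Matrix.pow_eq_of_charpoly hβ hY)
          (TorusKnotGroup.card_filter_add_le hρ hn hp hq hα hβ) (hlim α β hα hβ)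
      · intro hα1 hβ1
        exact tendsto_nhds_unique (hlim α β hα hβ) (torsionQuotient_tendsto_of_ne_one hα1 hβ1)
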